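/- Let $V\neq 0$ be a finite-dimensional complex vector space with a symplectic form $\omega$, and let $G$ be a finite group acting faithfully and linearly on $V$ and preserving $\omega$. Assume that $(\wedge^2V)^G=\mathbb C\omega$, i.e. (identifying $V$ with $V^*$ by $\omega$) every $G$-invariant alternating bilinear form on $V$ is a scalar multiple of $\omega$. Let $S\subset G$ be the set of symplectic reflections, i.e. of those $s\in G$ for which $1-s$ has rank $2$ on $V$; for $s\in S$ let $\omega_s(x,y)$ be $\omega$ applied to the projections of $x,y$ to $\mathrm{Im}(1-s)$ along $\mathrm{Ker}(1-s)$. Let $t\in\mathbb C$ and let $c:S\to\mathbb C$ be a function invariant under conjugation by $G$. Let the symplectic reflection algebra $H_{t,c}$ be the quotient of $\mathbb C[G]\ltimes \mathbf T(V)$, where $\mathbf T(V)$ is the tensor algebra, by the two-sided ideal generated by the relations $$xy-yx=t\,\omega(x,y)-2\sum_{s\in S}c_s\,\omega_s(x,y)\,s,\qquad x,y\in V,$$ and let $B_{t,c}=\mathbf e H_{t,c}\mathbf e$ be its spherical subalgebra, where $\mathbf e=\frac1{|G|}\sum_{g\in G}g$. Then $B_{t,c}$ is commutative if and only if $t=0$.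 -/

import Mathlib

noncomputable section

namespace SymplecticReflection

section Action

variable {G V : Type*} [Group G] [AddCommGroup V] [Module ℂ V]
  [DistribMulAction G V] [SMulCommClass G ℂ V]

/-- The algebra endomorphism of the tensor algebra `T(V)` induced by the action of `g` on `V`. -/
def tensorMap (g : G) : TensorAlgebra ℂ V →ₐ[ℂ] TensorAlgebra ℂ V :=
  TensorAlgebra.lift ℂ (TensorAlgebra.ι ℂ ∘ₗ DistribSMul.toLinearMap ℂ V g)

@[simp]
theorem tensorMap_ι (g : G) (x : V) :
    tensorMap g (TensorAlgebra.ι ℂ x) = TensorAlgebra.ι ℂ (g • x) := by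
  simp [tensorMap]

/-- A linear action of `G` on `V` extends to an action on `T(V)` by algebra automorphisms,
`g • (x₁ ⊗ ⋯ ⊗ xₙ) = (g • x₁) ⊗ ⋯ ⊗ (g • xₙ)`. -/
instance tensorAction : MulSemiringAction G (TensorAlgebra ℂ V) where
  smul g a := tensorMap g a
  one_smul a := by
    change tensorMap (1 : G) a = a
    have h : tensorMap (V := V) (1 : G) = AlgHom.id ℂ (TensorAlgebra ℂ V) :=
      TensorAlgebra.hom_ext (LinearMap.ext fun x => by simp)
    rw [h]; rfl
  mul_smul g h a := by
    change tensorMap (g * h) a = tensorMap g (tensorMap h a)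
    have e : tensorMap (V := V) (g * h) = (tensorMap g).comp (tensorMap h) :=
      TensorAlgebra.hom_ext (LinearMap.ext fun x => by simp [mul_smul])
    rw [e]; rfl
  smul_zero g := map_zero (tensorMap g)
  smul_add g := map_add (tensorMap g)
  smul_one g := map_one (tensorMap g)
  smul_mul g := map_mul (tensorMap g)

theorem smul_tensor_def (g : G) (a : TensorAlgebra ℂ V) : g • a = tensorMap g a := rfl

instance tensorAction_smulComm : SMulCommClass G ℂ (TensorAlgebra ℂ V) where
  smul_comm g z a := map_smul (tensorMap g) z a

end Action

section Reflections

variable (G V : Type*) [Group G] [AddCommGroup V] [Module ℂ V]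
  [DistribMulAction G V] [SMulCommClass G ℂ V]

variable {G} in
/-- The operator `1 - g` on `V`. -/
def oneSub (g : G) : V →ₗ[ℂ] V := LinearMap.id - DistribSMul.toLinearMap ℂ V g

variable {G} in
/-- For an element `g` of a finite group, `V` is the direct sum of the image and the kernel
of `1 - g`. -/
theorem isCompl_oneSub [Finite G] [FiniteDimensional ℂ V] (g : G) :
    IsCompl (LinearMap.range (oneSub V g)) (LinearMap.ker (oneSub V g)) := by
  refine (Submodule.isCompl_iff_disjoint _ _ ?_).2 ?_
  · rw [LinearMap.finrank_range_add_finrank_ker]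
  rw [Submodule.disjoint_def]
  rintro _ ⟨y, rfl⟩ hx
  set x := oneSub V g y with hxy
  have hgx : g • x = x := by
    have : x - g • x = 0 := hx
    exact (sub_eq_zero.1 this).symm
  have hgy : g • y = y - x := by
    have : x = y - g • y := hxy
    rw [this]; abel
  have key : ∀ k : ℕ, g ^ k • y = y - (k : ℂ) • x := by
    intro k
    induction k with
    | zero => simp
    | succ k ih =>
      rw [pow_succ', mul_smul, ih, smul_sub, hgy, smul_comm g (k : ℂ) x, hgx]
      push_cast
      rw [add_smul, one_smul]; abel
  have h := key (orderOf g)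
  rw [pow_orderOf_eq_one, one_smul, eq_comm, sub_eq_self] at h
  exact (smul_eq_zero.1 h).resolve_left (by exact_mod_cast (orderOf_pos g).ne')

/-- The set `S` of symplectic reflections in `G`: the elements `g` for which `g - 1` has rank `2`
on `V`. (For a symplectic action; the rank of `g - 1` is that of `1 - g`.) -/
def reflections : Set G := {g | Module.finrank ℂ (LinearMap.range (oneSub V g)) = 2}

end Reflections

section Algebra

variable {G V : Type*} [Group G] [Fintype G] [AddCommGroup V] [Module ℂ V]
  [FiniteDimensional ℂ V] [DistribMulAction G V] [SMulCommClass G ℂ V]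

/-- `ω_s(x, y)`: the form `ω` applied to the projections of `x`, `y` to the image of `1 - s`
along the kernel of `1 - s`. -/
def reflForm (ω : LinearMap.BilinForm ℂ V) (s : G) : LinearMap.BilinForm ℂ V :=
  ω.compl₁₂ (Submodule.projection _ _ (isCompl_oneSub V s))
    (Submodule.projection _ _ (isCompl_oneSub V s))

variable (G V) in
/-- The semidirect product `ℂ[G] ⋉ T(V)`. Its elements are the finite sums `∑ a_g g` with `a_g` in
`T(V)`, and `g a = (g • a) g`. -/
abbrev SkewTensor : Type _ := SkewMonoidAlgebra (TensorAlgebra ℂ V) G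

/-- The inclusion of `V` into `ℂ[G] ⋉ T(V)`. -/
def vec (x : V) : SkewTensor G V := SkewMonoidAlgebra.single 1 (TensorAlgebra.ι ℂ x)

open Classical in
/-- The defining relations
`x y - y x = t ω(x, y) - 2 ∑_{s ∈ S} c_s ω_s(x, y) s` for `x`, `y` in `V`. -/
inductive Rel (ω : LinearMap.BilinForm ℂ V) (t : ℂ) (c : reflections G V → ℂ) :
    SkewTensor G V → SkewTensor G V → Prop
  | comm (x y : V) : Rel ω t c
      (vec x * vec y - vec y * vec x)
      (algebraMap ℂ (SkewTensor G V) (t * ω x y) -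
        2 * ∑ s : reflections G V,
          (c s * reflForm ω (s : G) x y) •
            SkewMonoidAlgebra.of (TensorAlgebra ℂ V) G (s : G))

/-- The symplectic reflection algebra `H_{t,c}[V, G]`: the quotient of `ℂ[G] ⋉ T(V)` by the
two-sided ideal generated by the defining relations. -/
abbrev Alg (ω : LinearMap.BilinForm ℂ V) (t : ℂ) (c : reflections G V → ℂ) : Type _ :=
  RingQuot (Rel ω t c)

variable (ω : LinearMap.BilinForm ℂ V) (t : ℂ) (c : reflections G V → ℂ)

/-- The image of a group element in `H_{t,c}`. -/
def grp : G →* Alg ω t c :=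
  (RingQuot.mkAlgHom ℂ (Rel ω t c) : SkewTensor G V →* Alg ω t c).comp
    (SkewMonoidAlgebra.of (TensorAlgebra ℂ V) G)

/-- The symmetrizer `e = |G|⁻¹ ∑_{g ∈ G} g`, as an element of `H_{t,c}`. -/
def symmetrizer : Alg ω t c := (Fintype.card G : ℂ)⁻¹ • ∑ g : G, grp ω t c g

theorem isIdempotentElem_symmetrizer : IsIdempotentElem (symmetrizer ω t c) := by
  have h : ∀ g : G, grp ω t c g * ∑ k : G, grp ω t c k = ∑ k : G, grp ω t c k := by
    intro g
    rw [Finset.mul_sum]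
    simp_rw [← map_mul]
    exact Fintype.sum_equiv (Equiv.mulLeft g) _ _ fun _ => rfl
  have hc : (Fintype.card G : ℂ) ≠ 0 := by exact_mod_cast Fintype.card_ne_zero
  unfold IsIdempotentElem symmetrizer
  rw [smul_mul_smul_comm, Finset.sum_mul, Finset.sum_congr rfl fun g _ => h g, Finset.sum_const,
    Finset.card_univ, ← Nat.cast_smul_eq_nsmul ℂ, smul_smul, mul_assoc, inv_mul_cancel₀ hc,
    mul_one]

/-- The spherical subalgebra `B_{t,c} = e H_{t,c} e`, with unit `e`. -/
abbrev Spherical : Type _ := (isIdempotentElem_symmetrizer ω t c).Corner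

end Algebra

end SymplecticReflection

end

set_option linter.unusedSectionVars false

noncomputable section

namespace SymplecticReflection

/-! ### Derivations under finite group actions and their denominators. -/

section Derivations

/-! Filter `H = H_{t,c}` by word length. By the PBW theorem its associated graded algebra is `S(V) ⋊
G`, so that of `B = e H e` is the invariant ring `S(V)^G`. The commutator of elements of `B` of
orders `m` and `n` has order at most `m + n - 2`, and its symbol in that degree is `t` times the
Poisson bracket of the two symbols (`FlatAlgebra.commutator_mem_sph`). If `B` is commutative, `t{ ,
}` vanishes on invariants. A derivation of `S(V)` killing the invariants is zero
(`derivation_eq_zero_of_invariant`), so `tω = 0` and `t = 0`.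

Conversely, let `t = 0`; then commutators have order at most `m + n - 3`. Suppose that the bound `m
+ n - d` holds, with `d ≥ 3`. The symbols in degree `m + n - d` define a biderivation of `S(V)^G` of
degree `-d`. For `g ≠ 1` the image of `1 - g` is not isotropic, so the fixed space of `g` has
codimension at least 2 and `S(V)` is unramified over the invariants in codimension one. Hence
derivations `S(V)^G → S(V)` extend to `S(V)` (`exists_derivation_extending`), and the biderivation
takes the form `∑ ∂_j a ∂_i b E_{ij}`. For homogeneous `a`, `b` of degrees `m`, `n` this has no
terms in degree below `m + n - 2`, so it is zero (`biderivation_eq_zero`) and `d` can be raised by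
one. Once the order is negative the commutator is zero.

PBW is proved by building, one word length at a time, a polynomial-valued multilinear function of
words that respects the commutation relations and has the symmetric product as leading term. The
operators interchanging two adjacent letters, with their correction terms, are affine and satisfy
the Coxeter relations of type `A`. They therefore have finite orbits, and the barycentre of an orbit
is a common fixed point (`exists_wordRel_succ`). `H` acts on such functions by right translation,
and evaluation gives a normal form (`exists_flatAlgebra`). -/

open Polynomial in
theorem derivation_eval {P M : Type*} [CommRing P] [Algebra ℂ P] [AddCommGroup M] [Module ℂ M]
    [Module P M] (D : Derivation ℂ P M) (p : P[X]) (y : P) :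
    D (p.eval y) = p.sum (fun i a => y ^ i • D a) + p.derivative.eval y • D y := by
  induction p using Polynomial.induction_on' with
  | add p q hp hq =>
    rw [Polynomial.sum_add_index _ _ _ (by simp) (by intros; simp), eval_add, map_add, hp, hq,
      derivative_add, eval_add, add_smul]
    abel
  | monomial n a =>
    rw [Polynomial.sum_monomial_index _ _ (by simp), eval_monomial, D.leibniz, D.leibniz_pow,
      derivative_monomial, eval_monomial, ← Nat.cast_smul_eq_nsmul P, smul_smul, smul_smul, add_comm]

/-- Applying a derivation `D` to `∏ (X - g y) = 0` at `X = y`. -/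
theorem derivation_smul_prod_mem {G P M : Type*} [Group G] [Fintype G] [DecidableEq G] [CommRing P]
    [Algebra ℂ P] [MulSemiringAction G P] [AddCommGroup M] [Module ℂ M] [Module P M]
    (D : Derivation ℂ P M) (N : Submodule P M) (hN : ∀ a : P, (∀ g : G, g • a = a) → D a ∈ N)
    (y : P) : (∏ g ∈ Finset.univ.erase (1 : G), (y - g • y)) • D y ∈ N := by
  have h := derivation_eval D (MulSemiringAction.charpoly G y) y
  rw [MulSemiringAction.eval_charpoly, map_zero] at h
  -- The factor of `g = 1` vanishes at `y`, so only the term of the derivative that omits it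
  -- survives.
  have h1 : (MulSemiringAction.charpoly G y).derivative.eval y =
      ∏ g ∈ Finset.univ.erase (1 : G), (y - g • y) := by
    rw [MulSemiringAction.charpoly_eq, ← Finset.mul_prod_erase _ _ (Finset.mem_univ (1 : G))]
    simp [Polynomial.eval_prod]
  rw [h1] at h
  rw [← neg_eq_of_add_eq_zero_right h.symm]
  refine N.neg_mem (N.sum_mem fun i _ => N.smul_mem _ (hN _ fun g => ?_))
  exact MulSemiringAction.smul_coeff_charpoly y i g

-- The fraction field of `P` is algebraic over that of `A`, hence separable in characteristic zero,
-- hence formally étale over `A`. So its Kähler differentials are the base change of those of `A`,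
-- and derivations extend.
open KaehlerDifferential in
theorem exists_derivation_fractionRing {A P : Type*} [CommRing A] [CommRing P] [IsDomain P]
    [Algebra ℂ A] [Algebra A P] [Algebra ℂ P] [IsScalarTower ℂ A P] [FaithfulSMul A P]
    [Algebra.IsIntegral A P] (δ : Derivation ℂ A P) :
    ∃ D : Derivation ℂ (FractionRing P) (FractionRing P),
      ∀ a : A, D (algebraMap A _ a) = algebraMap P _ (δ a) := by
  have : IsDomain A := IsDomain.of_faithfulSMul A P
  let L := FractionRing P
  let K := FractionRing A
  let _ : Algebra K L := FractionRing.liftAlgebra A L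
  have : IsScalarTower A K L := FractionRing.isScalarTower_liftAlgebra A L
  have : Algebra.IsAlgebraic A L := by
    have : Algebra.IsAlgebraic P L := IsLocalization.isAlgebraic L (nonZeroDivisors P)
    exact Algebra.IsAlgebraic.trans A P L
  have : Algebra.IsAlgebraic K L :=
    ⟨fun _ => (IsFractionRing.isAlgebraic_iff A K L).1 (Algebra.IsAlgebraic.isAlgebraic _)⟩
  have : CharZero K := charZero_of_injective_algebraMap (algebraMap ℂ K).injective
  have : Algebra.FormallyEtale K L := Algebra.FormallyEtale.of_isSeparable K L
  have : Algebra.FormallyEtale A K := Algebra.FormallyEtale.of_isLocalization (nonZeroDivisors A)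
  have : Algebra.FormallyEtale A L := Algebra.FormallyEtale.comp A K L
  let e := tensorKaehlerEquivOfFormallyEtale ℂ A L
  let f : Ω[A⁄ℂ] →ₗ[A] L := (IsScalarTower.toAlgHom A P L).toLinearMap ∘ₗ δ.liftKaehlerDifferential
  let F : Ω[L⁄ℂ] →ₗ[L] L := (LinearMap.liftBaseChange L f) ∘ₗ e.symm.toLinearMap
  refine ⟨F.compDer (KaehlerDifferential.D ℂ L), fun a => ?_⟩
  have h := tensorKaehlerEquivOfFormallyEtale_symm_D_algebraMap ℂ A L a
  refine (congrArg (LinearMap.liftBaseChange L f) h).trans ?_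
  simp [f]
  rfl

/-- If the denominators of `T x` divide a product of nonzero linear functions `u i x`, none of
which has a fixed prime divisor, then `T x` has no denominators. -/
theorem exists_algebraMap_eq_of_prod_smul {P V ι : Type*} [CommRing P] [IsDomain P]
    [UniqueFactorizationMonoid P] [Algebra ℂ P] [AddCommGroup V] [Module ℂ V] (s : Finset ι)
    (u : ι → V →ₗ[ℂ] P) (hu : ∀ i ∈ s, ∀ p : P, Prime p → ∃ x, ¬ p ∣ u i x)
    (T : V →ₗ[ℂ] FractionRing P)
    (hT : ∀ x, ∃ f : P, algebraMap P (FractionRing P) f = (∏ i ∈ s, u i x) • T x)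
    {q : P} (hq : q ≠ 0) (hqT : ∀ x, ∃ f : P, algebraMap P (FractionRing P) f = q • T x) (x : V) :
    ∃ f : P, algebraMap P (FractionRing P) f = T x := by
  revert x
  have inj : Function.Injective (algebraMap P (FractionRing P)) :=
    IsFractionRing.injective P (FractionRing P)
  induction q using UniqueFactorizationMonoid.induction_on_prime with
  | h₁ => exact absurd rfl hq
  | h₂ q hu =>
    intro x
    obtain ⟨f, hf⟩ := hqT x
    obtain ⟨v, rfl⟩ := hu
    exact ⟨↑v⁻¹ * f, by rw [map_mul, hf, ← Algebra.smul_def, smul_smul, Units.inv_mul, one_smul]⟩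
  | h₃ q p hq0 hp ih =>
    refine ih hq0 ?_
    -- The index `none` collects the `x` for which the prime `p` can be dropped from the
    -- denominator, and `some i` those with `p ∣ u i x`. These subspaces cover `V`; since `ℂ` is
    -- infinite, one of them is all of `V`, and it cannot be one of the latter.
    let W : Option s → Submodule ℂ V := fun o => o.elim
      (Submodule.comap (LinearMap.lsmul P (FractionRing P) q |>.restrictScalars ℂ |>.comp T)
        (LinearMap.range (Algebra.linearMap P (FractionRing P)) |>.restrictScalars ℂ))
      (fun i => ((Ideal.span {p}).restrictScalars ℂ).comap (u i))
    have hW : ⋃ o, (W o : Set V) = Set.univ := by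
      rw [Set.eq_univ_iff_forall]
      intro x
      obtain ⟨f, hf⟩ := hqT x
      obtain ⟨h, hh⟩ := hT x
      have e : (∏ i ∈ s, u i x) * f = p * (q * h) := by
        apply inj
        simp only [map_mul, hf, hh, Algebra.smul_def]
        ring
      rw [Set.mem_iUnion]
      rcases hp.dvd_or_dvd (Dvd.intro _ e.symm) with hd | ⟨f', rfl⟩
      · obtain ⟨i, hi, hd⟩ := hp.exists_mem_finset_dvd hd
        exact ⟨some ⟨i, hi⟩, Ideal.mem_span_singleton.2 hd⟩
      · refine ⟨none, f', ?_⟩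
        have hp0 : algebraMap P (FractionRing P) p ≠ 0 :=
          (map_ne_zero_iff _ inj).2 hp.ne_zero
        apply mul_left_cancel₀ hp0
        rw [Algebra.linearMap_apply, ← map_mul, hf, mul_smul, Algebra.smul_def p]
        rfl
    obtain ⟨o, ho⟩ := Subspace.exists_eq_top_of_iUnion_eq_univ hW
    match o, ho with
    | none, ho =>
      intro x
      have : x ∈ W none := ho ▸ Submodule.mem_top
      exact this
    | some i, ho =>
      obtain ⟨x, hx⟩ := hu i i.2 p hp
      have : x ∈ W (some i) := ho ▸ Submodule.mem_top
      exact absurd (Ideal.mem_span_singleton.1 this) hx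

end Derivations

/-! ### Derivations and biderivations on invariant polynomials. -/

section InvariantPolynomials

open MvPolynomial

theorem derivation_sum_apply {σ P M : Type*} [CommRing P] [Algebra ℂ P] [AddCommGroup M]
    [Module ℂ M] [Module P M] (s : Finset σ) (D : σ → Derivation ℂ P M) (f : P) :
    (∑ i ∈ s, D i) f = ∑ i ∈ s, D i f := by
  rw [← Derivation.coeFnAddMonoidHom_apply, map_sum, Finset.sum_apply]
  rfl

theorem derivation_apply_eq_sum {σ M : Type*} [Fintype σ] [AddCommGroup M] [Module ℂ M]
    [Module (MvPolynomial σ ℂ) M] [IsScalarTower ℂ (MvPolynomial σ ℂ) M]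
    (E : Derivation ℂ (MvPolynomial σ ℂ) M) (f : MvPolynomial σ ℂ) :
    E f = ∑ i, pderiv i f • E (X i) := by
  classical
  have : E = ∑ i, (LinearMap.toSpanSingleton _ M (E (X i))).compDer (pderiv i) := by
    refine derivation_ext fun j => ?_
    rw [derivation_sum_apply]
    simp [pderiv_X, Pi.single_apply]
  conv_lhs => rw [this, derivation_sum_apply]
  rfl

theorem homogeneousComponent_mul_eq_zero {σ : Type*} {h f : MvPolynomial σ ℂ} {r k : ℕ}
    (hh : h.IsHomogeneous r) (hk : k < r) : homogeneousComponent k (h * f) = 0 := by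
  rw [← sum_homogeneousComponent f, Finset.mul_sum, map_sum]
  refine Finset.sum_eq_zero fun i _ => ?_
  rw [homogeneousComponent_of_mem (hh.mul (homogeneousComponent_isHomogeneous i f)), if_neg]
  omega

theorem eq_zero_of_homogeneousComponent {σ : Type*} {f : MvPolynomial σ ℂ}
    (h : ∀ k, homogeneousComponent k f = 0) : f = 0 := by
  rw [← sum_homogeneousComponent f]
  exact Finset.sum_eq_zero fun i _ => h i

variable {G V σ : Type*} [Group G] [Fintype G] [AddCommGroup V] [Module ℂ V]
  [DistribMulAction G V] [SMulCommClass G ℂ V]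
  [MulSemiringAction G (MvPolynomial σ ℂ)]

/-- For each `x`, the product of the `lin x - g • lin x` over `g ≠ 1` annihilates `E (lin x)`. So
`V` is a finite union of the fixed spaces of the `g ≠ 1`, which are proper, and of the kernel of `E
∘ lin`, which must be everything. -/
theorem derivation_eq_zero_of_invariant
    (lin : V →ₗ[ℂ] MvPolynomial σ ℂ) (hX : ∀ i, ∃ x, lin x = X i)
    (hlin : ∀ (g : G) x, lin (g • x) = g • lin x)
    (hp : ∀ g : G, g ≠ 1 → ∀ p, Prime p → ∃ x, ¬ p ∣ lin x - lin (g • x))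
    (E : Derivation ℂ (MvPolynomial σ ℂ) (MvPolynomial σ ℂ))
    (hE : ∀ a, (∀ g : G, g • a = a) → E a = 0) : E = 0 := by
  classical
  refine derivation_ext fun i => ?_
  let W : G → Submodule ℂ V := fun g => if g = 1 then LinearMap.ker (E.toLinearMap ∘ₗ lin)
    else LinearMap.ker (lin - lin ∘ₗ DistribSMul.toLinearMap ℂ V g)
  have hW : ⋃ o, (W o : Set V) = Set.univ := by
    rw [Set.eq_univ_iff_forall]
    intro x
    rw [Set.mem_iUnion]
    have h := derivation_smul_prod_mem (G := G) E ⊥ (by simpa using hE) (lin x)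
    rw [Submodule.mem_bot, smul_eq_mul, mul_eq_zero, Finset.prod_eq_zero_iff] at h
    rcases h with ⟨g, hg, h⟩ | h
    · refine ⟨g, ?_⟩
      simp only [W, if_neg (Finset.ne_of_mem_erase hg)]
      simpa [hlin] using h
    · refine ⟨1, ?_⟩
      simpa [W] using h
  obtain ⟨g, ho⟩ := Subspace.exists_eq_top_of_iUnion_eq_univ hW
  by_cases hg : g = 1
  · obtain ⟨x, hx⟩ := hX i
    have : x ∈ W g := ho ▸ Submodule.mem_top
    rw [← hx]
    simpa [W, hg] using this
  · obtain ⟨x, hx⟩ := hp g hg (X i) X_prime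
    have : x ∈ W g := ho ▸ Submodule.mem_top
    simp only [W, if_neg hg] at this
    refine absurd ?_ hx
    have e : lin x - lin (g • x) = 0 := this
    rw [e]
    exact dvd_zero _

/-- The derivation extends to the fraction field, where the denominator of the value at `lin x`
divides `∏ (lin x - g • lin x)`. By `hp`, which says that fixed loci have codimension at least 2, no
prime divides any one factor for all `x`, so the denominators disappear. -/
theorem exists_derivation_extending [Fintype σ] [SMulCommClass G ℂ (MvPolynomial σ ℂ)]
    (lin : V →ₗ[ℂ] MvPolynomial σ ℂ) (hX : ∀ i, ∃ x, lin x = X i)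
    (hlin : ∀ (g : G) x, lin (g • x) = g • lin x)
    (hp : ∀ g : G, g ≠ 1 → ∀ p, Prime p → ∃ x, ¬ p ∣ lin x - lin (g • x))
    (δ : Derivation ℂ (FixedPoints.subalgebra ℂ (MvPolynomial σ ℂ) G) (MvPolynomial σ ℂ)) :
    ∃ E : Derivation ℂ (MvPolynomial σ ℂ) (MvPolynomial σ ℂ), ∀ a : FixedPoints.subalgebra ℂ (MvPolynomial σ ℂ) G,
      E a = δ a := by
  classical
  let P := MvPolynomial σ ℂ
  let A := FixedPoints.subalgebra ℂ P G
  have hinv : Algebra.IsInvariant A P G := ⟨fun b hb => ⟨⟨b, hb⟩, rfl⟩⟩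
  have : Algebra.IsIntegral A P := Algebra.IsInvariant.isIntegral A P G
  obtain ⟨D, hD⟩ := exists_derivation_fractionRing δ
  let L := FractionRing P
  let D' : Derivation ℂ P L := D.compAlgebraMap P
  let N : Submodule P L := LinearMap.range (Algebra.linearMap P L)
  have inj : Function.Injective (algebraMap P L) := IsFractionRing.injective P L
  have h1 : ∀ x : V, ∃ f : P, algebraMap P L f =
      (∏ g ∈ Finset.univ.erase (1 : G), (lin - lin ∘ₗ DistribSMul.toLinearMap ℂ V g) x) •
        (D'.toLinearMap ∘ₗ lin) x := by
    intro x
    have := derivation_smul_prod_mem (G := G) D' N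
      (fun a ha => ⟨δ ⟨a, ha⟩, (hD ⟨a, ha⟩).symm⟩) (lin x)
    obtain ⟨f, hf⟩ := this
    refine ⟨f, hf.trans ?_⟩
    simp [hlin]
  have h2 : ∃ q : P, q ≠ 0 ∧ ∀ f : P, ∃ f' : P, algebraMap P L f' = q • D' f := by
    obtain ⟨q, hq⟩ := IsLocalization.exist_integer_multiples_of_finset (nonZeroDivisors P)
      (Finset.univ.image fun i => D' (X i))
    refine ⟨q, nonZeroDivisors.coe_ne_zero q, fun f => ?_⟩
    have hf : D' f = ∑ i, pderiv i f • D' (X i) := derivation_apply_eq_sum D' f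
    change (q : P) • D' f ∈ N
    rw [hf, Finset.smul_sum]
    refine N.sum_mem fun i _ => ?_
    rw [smul_comm]
    refine N.smul_mem _ ?_
    obtain ⟨f', hf'⟩ := hq (D' (X i)) (Finset.mem_image_of_mem _ (Finset.mem_univ i))
    exact ⟨f', hf'⟩
  obtain ⟨q, hq, hq'⟩ := h2
  have h3 := exists_algebraMap_eq_of_prod_smul _
    (fun g : G => lin - lin ∘ₗ DistribSMul.toLinearMap ℂ V g)
    (fun g hg p hp' => hp g (Finset.ne_of_mem_erase hg) p hp') (D'.toLinearMap ∘ₗ lin) h1 hq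
    (fun x => hq' (lin x))
  have h4 : ∀ i, ∃ f : P, algebraMap P L f = D' (X i) := by
    intro i
    obtain ⟨x, hx⟩ := hX i
    rw [← hx]
    exact h3 x
  choose f hf using h4
  let E : Derivation ℂ P P := mkDerivation ℂ f
  have hE : (Algebra.linearMap P L).compDer E = D' := by
    refine derivation_ext fun i => ?_
    change algebraMap P L (E (X i)) = _
    rw [mkDerivation_X, hf]
  refine ⟨E, fun a => inj ?_⟩
  exact (congrArg (fun T => T (a : P)) hE).trans (hD a)

/-- Two derivations in each variable of degree `-d` on the invariants vanish when `d ≥ 3`. -/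
theorem biderivation_eq_zero [Fintype σ] [SMulCommClass G ℂ (MvPolynomial σ ℂ)]
    (lin : V →ₗ[ℂ] MvPolynomial σ ℂ) (hX : ∀ i, ∃ x, lin x = X i)
    (hlin : ∀ (g : G) x, lin (g • x) = g • lin x)
    (hp : ∀ g : G, g ≠ 1 → ∀ p, Prime p → ∃ x, ¬ p ∣ lin x - lin (g • x))
    (π : MvPolynomial σ ℂ →ₗ[ℂ] MvPolynomial σ ℂ →ₗ[ℂ] MvPolynomial σ ℂ)
    (hl : ∀ a a' b, (∀ g : G, g • a = a) → (∀ g : G, g • a' = a') → (∀ g : G, g • b = b) →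
      π (a * a') b = a * π a' b + a' * π a b)
    (hr : ∀ a b b', (∀ g : G, g • a = a) → (∀ g : G, g • b = b) → (∀ g : G, g • b' = b') →
      π a (b * b') = b * π a b' + b' * π a b) {d m n : ℕ} (hd : 3 ≤ d)
    {a b : MvPolynomial σ ℂ} (hag : ∀ g : G, g • a = a) (hbg : ∀ g : G, g • b = b)
    (ham : a.IsHomogeneous m) (hbn : b.IsHomogeneous n)
    (hπ : ∀ k, k + d ≠ m + n → homogeneousComponent k (π a b) = 0) : π a b = 0 := by
  classical
  let P := MvPolynomial σ ℂ
  let A := FixedPoints.subalgebra ℂ P G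
  let δ (a : A) : Derivation ℂ A P := Derivation.mk' (π a ∘ₗ A.val.toLinearMap)
    fun b b' => hr a b b' a.2 b.2 b'.2
  choose D hD using fun a => exists_derivation_extending lin hX hlin hp (δ a)
  have uniq : ∀ E E' : Derivation ℂ P P, (∀ b : A, E b = E' b) → E = E' := fun E E' h =>
    sub_eq_zero.1 (derivation_eq_zero_of_invariant lin hX hlin hp (E - E')
      fun b hb => sub_eq_zero.2 (h ⟨b, hb⟩))
  have hD' : ∀ a b : A, D a b = π a b := fun a b => hD a b
  have hadd : ∀ a a', D (a + a') = D a + D a' := fun a a' => uniq _ _ fun b => by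
    simp [hD']
  have hsmul : ∀ (z : ℂ) a, D (z • a) = z • D a := fun z a => uniq _ _ fun b => by
    simp [hD']
  have hmul : ∀ a a', D (a * a') = a • D a' + a' • D a := fun a a' => uniq _ _ fun b => by
    rw [hD']
    refine (hl a a' b a.2 a'.2 b.2).trans ?_
    rw [← hD', ← hD']
    rfl
  -- The extensions `D a` are unique, so they depend on `a` as a derivation. The first variable can
  -- then be extended in the same way.
  let ε (i : σ) : Derivation ℂ A P := Derivation.mk'
    { toFun := fun a => D a (X i)
      map_add' := fun a a' => by rw [hadd]; rfl
      map_smul' := fun z a => by rw [hsmul]; rfl }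
    fun a a' => by
      change D (a * a') (X i) = _
      rw [hmul]
      rfl
  choose E hE using fun i => exists_derivation_extending lin hX hlin hp (ε i)
  have key : π a b = ∑ i, ∑ j, (pderiv j a * pderiv i b) * E i (X j) := by
    have h1 : π a b = D (⟨a, hag⟩ : A) b := (hD' ⟨a, hag⟩ ⟨b, hbg⟩).symm
    rw [h1, derivation_apply_eq_sum (D _) b]
    refine Finset.sum_congr rfl fun i _ => ?_
    have h2 : D (⟨a, hag⟩ : A) (X i) = E i a := (hE i ⟨a, hag⟩).symm
    rw [h2, derivation_apply_eq_sum (E i) a, smul_eq_mul, Finset.mul_sum]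
    refine Finset.sum_congr rfl fun j _ => ?_
    rw [smul_eq_mul]
    ring
  refine eq_zero_of_homogeneousComponent fun k => ?_
  by_cases hk : k + d = m + n
  · rw [key, map_sum]
    refine Finset.sum_eq_zero fun i _ => ?_
    rw [map_sum]
    refine Finset.sum_eq_zero fun j _ => ?_
    -- The product of the two partial derivatives is homogeneous of degree `(m - 1) + (n - 1)`,
    -- which exceeds `k = m + n - d` because `d ≥ 3`; truncated subtraction only raises the former.
    exact homogeneousComponent_mul_eq_zero
      (ham.pderiv.mul hbn.pderiv) (by omega)
  · exact hπ k hk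

end InvariantPolynomials

/-! ### Finiteness of orbits for Coxeter relations of type `A`. -/

section Orbits

/-- Iterated application of `A k`, `A (k + 1)`, …, `A (k + i - 1)`. -/
def chain {X : Type*} (A : ℕ → X → X) (k : ℕ) : ℕ → X → X
  | 0, x => x
  | i + 1, x => A (k + i) (chain A k i x)

theorem chain_comm {X : Type*} {A : ℕ → X → X} {N : ℕ}
    (hcomm : ∀ p q, p + 2 ≤ q → q < N → ∀ x, A p (A q x) = A q (A p x))
    {k p : ℕ} (hp : p < N) : ∀ i, k + i + 1 ≤ p → ∀ x, A p (chain A k i x) = chain A k i (A p x)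
  | 0, _, x => rfl
  | i + 1, h, x => by
    simp only [chain]
    rw [← hcomm _ _ (by omega) hp, chain_comm hcomm hp i (by omega)]

/-- The chains play the role of coset representatives of one symmetric group in the next: a
generator moved through a longer chain has its index shifted by one. -/
theorem chain_braid {X : Type*} {A : ℕ → X → X} {N : ℕ}
    (hcomm : ∀ p q, p + 2 ≤ q → q < N → ∀ x, A p (A q x) = A q (A p x))
    (hbraid : ∀ p, p + 1 < N → ∀ x, A p (A (p + 1) (A p x)) = A (p + 1) (A p (A (p + 1) x)))
    {k j : ℕ} : ∀ i, k + (j + 2 + i) ≤ N → ∀ x,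
      A (k + j) (chain A k (j + 2 + i) x) = chain A k (j + 2 + i) (A (k + j + 1) x)
  | 0, h, x => by
    change A (k + j) (A (k + j + 1) (A (k + j) (chain A k j x))) =
      A (k + j + 1) (A (k + j) (chain A k j (A (k + j + 1) x)))
    rw [hbraid _ (by omega), chain_comm hcomm (by omega) j (by omega)]
  | i + 1, h, x => by
    change A (k + j) (A (k + (j + 2 + i)) (chain A k (j + 2 + i) x)) =
      A (k + (j + 2 + i)) (chain A k (j + 2 + i) (A (k + j + 1) x))
    rw [hcomm _ _ (by omega) (by omega), chain_braid hcomm hbraid i (by omega)]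

/-- Maps satisfying the Coxeter relations of type `A` have finite orbits. -/
theorem exists_finite_stable {X : Type*} (A : ℕ → X → X) (N : ℕ)
    (hinv : ∀ p, p < N → ∀ x, A p (A p x) = x)
    (hcomm : ∀ p q, p + 2 ≤ q → q < N → ∀ x, A p (A q x) = A q (A p x))
    (hbraid : ∀ p, p + 1 < N → ∀ x, A p (A (p + 1) (A p x)) = A (p + 1) (A p (A (p + 1) x)))
    (Q : X → Prop) (hQ : ∀ p, p < N → ∀ x, Q x → Q (A p x)) (x : X) (hx : Q x) :
    ∃ O : Set X, O.Finite ∧ x ∈ O ∧ (∀ o ∈ O, Q o) ∧ ∀ p, p < N → ∀ o ∈ O, A p o ∈ O := by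
  -- Induction on the number of generators, adding them from the last to the first. The new set is
  -- the union of the images of the old one under the chains that start at `A k`.
  suffices H : ∀ i k, k + i = N → ∃ O : Set X, O.Finite ∧ x ∈ O ∧ (∀ o ∈ O, Q o) ∧
      ∀ p, k ≤ p → p < N → ∀ o ∈ O, A p o ∈ O by
    obtain ⟨O, h1, h2, h3, h4⟩ := H N 0 (by omega)
    exact ⟨O, h1, h2, h3, fun p => h4 p (Nat.zero_le _)⟩
  intro i
  induction i with
  | zero =>
    intro k hk
    exact ⟨{x}, Set.finite_singleton x, rfl, by rintro _ rfl; exact hx, by intros; omega⟩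
  | succ i ih =>
    intro k hk
    obtain ⟨O, h1, h2, h3, h4⟩ := ih (k + 1) (by omega)
    refine ⟨⋃ j ∈ Set.Iic (i + 1), chain A k j '' O,
      (Set.finite_Iic _).biUnion fun j _ => h1.image _, ?_, ?_, ?_⟩
    · exact Set.mem_biUnion (x := 0) (by simp) ⟨x, h2, rfl⟩
    · intro o ho
      simp only [Set.mem_iUnion, Set.mem_Iic, Set.mem_image] at ho
      obtain ⟨j, hj, y, hy, rfl⟩ := ho
      induction j with
      | zero => exact h3 y hy
      | succ j ihj => exact hQ _ (by omega) _ (ihj (by omega))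
    · intro p hkp hpN o ho
      simp only [Set.mem_iUnion, Set.mem_Iic, Set.mem_image] at ho ⊢
      obtain ⟨j, hj, y, hy, rfl⟩ := ho
      -- If `p = k + j - 1`, the outermost map of the chain is cancelled. A smaller `p` passes
      -- through as `p + 1`, `p = k + j` lengthens the chain, and a larger `p` commutes with it.
      rcases lt_trichotomy p (k + j) with h | h | h
      · obtain ⟨j, rfl⟩ : ∃ j', j = j' + 1 := ⟨j - 1, by omega⟩
        by_cases hpj : p = k + j
        · subst hpj
          exact ⟨j, by omega, y, hy, (hinv _ hpN _).symm⟩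
        · obtain ⟨r, rfl⟩ : ∃ r, p = k + r := ⟨p - k, by omega⟩
          obtain ⟨s, rfl⟩ : ∃ s, j = r + 1 + s := ⟨j - (r + 1), by omega⟩
          refine ⟨r + 2 + s, by omega, A (k + r + 1) y, h4 _ (by omega) (by omega) _ hy, ?_⟩
          rw [← chain_braid hcomm hbraid s (by omega)]
          congr 2
          omega
      · subst h
        exact ⟨j + 1, by omega, y, hy, rfl⟩
      · exact ⟨j, hj, A p y, h4 p (by omega) hpN y hy, (chain_comm hcomm hpN j (by omega) y).symm⟩

end Orbits

/-! ### Multilinear functions of words and contraction of adjacent letters. -/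

section Words

variable {G V M : Type*} [Group G] [Fintype G] [AddCommGroup V] [Module ℂ V]
  [DistribMulAction G V] [SMulCommClass G ℂ V] [AddCommGroup M] [Module ℂ M]

/-- A function of words in `V` is multilinear if it is linear in each letter. -/
def Multi (ℓ : List V → G → M) : Prop :=
  ∀ u v g, IsLinearMap ℂ fun x => ℓ (u ++ x :: v) g

/-- Interchange the letters in positions `p` and `p + 1`. -/
def swapAt : ℕ → List V → List V
  | 0, x :: y :: v => y :: x :: v
  | p + 1, x :: w => x :: swapAt p w
  | _, w => w

/-- Replace the letters `x`, `y` in positions `p` and `p + 1` by the group algebra element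
`∑ κ k x y • k`. -/
def contr (κ : G → LinearMap.BilinForm ℂ V) : ℕ → (List V → G → M) → List V → G → M
  | 0, ℓ, x :: y :: v, g => ∑ k, κ k x y • ℓ (v.map (k • ·)) (k * g)
  | p + 1, ℓ, x :: w, g => contr κ p (fun w' => ℓ (x :: w')) w g
  | _, _, _, _ => 0

/-- The relations `x y - y x = ∑ κ k x y • k`, for words of length less than `n`. -/
def WordRel (κ : G → LinearMap.BilinForm ℂ V) (n : ℕ) (ℓ : List V → G → M) : Prop :=
  ∀ u x y v g, u.length + 2 + v.length < n → ℓ (u ++ x :: y :: v) g - ℓ (u ++ y :: x :: v) g =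
    ∑ k, κ k x y • ℓ (u ++ v.map (k • ·)) (k * g)

@[simp]
theorem swapAt_append (u v : List V) (x y : V) :
    swapAt u.length (u ++ x :: y :: v) = u ++ y :: x :: v := by
  induction u with
  | nil => rfl
  | cons z u ih => simp [swapAt, ih]

@[simp]
theorem length_swapAt : ∀ (p : ℕ) (w : List V), (swapAt p w).length = w.length
  | 0, [] => rfl
  | 0, [_] => rfl
  | 0, _ :: _ :: _ => rfl
  | _ + 1, [] => rfl
  | p + 1, x :: w => by simp [swapAt, length_swapAt p w]

theorem contr_append (κ : G → LinearMap.BilinForm ℂ V) (ℓ : List V → G → M) (u v : List V)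
    (x y : V) (g : G) : contr κ u.length ℓ (u ++ x :: y :: v) g =
      ∑ k, κ k x y • ℓ (u ++ v.map (k • ·)) (k * g) := by
  induction u generalizing ℓ with
  | nil => rfl
  | cons z u ih => simp [contr, ih]

theorem exists_eq_append {α : Type*} : ∀ (p : ℕ) (w : List α), p ≤ w.length →
    ∃ u v, u.length = p ∧ w = u ++ v := fun p w h =>
  ⟨w.take p, w.drop p, by simpa using h, (List.take_append_drop p w).symm⟩

theorem exists_eq_append_two {α : Type*} (p : ℕ) (w : List α) (h : p + 2 ≤ w.length) :
    ∃ u x y v, u.length = p ∧ w = u ++ x :: y :: v := by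
  obtain ⟨u, v, hu, rfl⟩ := exists_eq_append p w (by omega)
  match v, h with
  | [], h => simp [hu] at h
  | [_], h => simp [hu] at h
  | x :: y :: v, h => exact ⟨u, x, y, v, hu, rfl⟩

theorem exists_eq_append_three {α : Type*} (p : ℕ) (w : List α) (h : p + 3 ≤ w.length) :
    ∃ u x y z v, u.length = p ∧ w = u ++ x :: y :: z :: v := by
  obtain ⟨u, x, y, v, hu, rfl⟩ := exists_eq_append_two p w (by omega)
  match v, h with
  | [], h => simp [hu] at h
  | z :: v, h => exact ⟨u, x, y, z, v, hu, rfl⟩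

theorem Multi.cons {ℓ : List V → G → M} (h : Multi ℓ) (x : V) : Multi fun w => ℓ (x :: w) :=
  fun u v g => h (x :: u) v g

theorem isLinearMap_add {α β : Type*} [AddCommGroup α] [Module ℂ α] [AddCommGroup β] [Module ℂ β]
    {f g : α → β} (hf : IsLinearMap ℂ f) (hg : IsLinearMap ℂ g) :
    IsLinearMap ℂ fun x => f x + g x :=
  (hf.mk' f + hg.mk' g).isLinear

theorem isLinearMap_smul {α β : Type*} [AddCommGroup α] [Module ℂ α] [AddCommGroup β]
    [Module ℂ β] {f : α → β} (z : ℂ) (hf : IsLinearMap ℂ f) : IsLinearMap ℂ fun x => z • f x :=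
  (z • hf.mk' f).isLinear

theorem isLinearMap_sum {α β ι : Type*} [AddCommGroup α] [Module ℂ α] [AddCommGroup β]
    [Module ℂ β] (s : Finset ι) {f : ι → α → β} (hf : ∀ i, IsLinearMap ℂ (f i)) :
    IsLinearMap ℂ fun x => ∑ i ∈ s, f i x := by
  constructor
  · intro x y
    simp [(hf _).map_add, Finset.sum_add_distrib]
  · intro c x
    simp [(hf _).map_smul, Finset.smul_sum]

theorem isLinearMap_zero {α β : Type*} [AddCommGroup α] [Module ℂ α] [AddCommGroup β]
    [Module ℂ β] : IsLinearMap ℂ fun _ : α => (0 : β) := (0 : α →ₗ[ℂ] β).isLinear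

theorem contr_add (κ : G → LinearMap.BilinForm ℂ V) : ∀ (p : ℕ) (ℓ ℓ' : List V → G → M)
    (w : List V) (g : G), contr κ p (ℓ + ℓ') w g = contr κ p ℓ w g + contr κ p ℓ' w g
  | 0, _, _, [], _ => by simp [contr]
  | 0, _, _, [_], _ => by simp [contr]
  | 0, _, _, _ :: _ :: _, _ => by simp [contr, Finset.sum_add_distrib]
  | _ + 1, _, _, [], _ => by simp [contr]
  | p + 1, ℓ, ℓ', x :: w, g => contr_add κ p _ _ w g

theorem contr_smul (κ : G → LinearMap.BilinForm ℂ V) (z : ℂ) : ∀ (p : ℕ) (ℓ : List V → G → M)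
    (w : List V) (g : G), contr κ p (z • ℓ) w g = z • contr κ p ℓ w g
  | 0, _, [], _ => by simp [contr]
  | 0, _, [_], _ => by simp [contr]
  | 0, _, _ :: _ :: _, _ => by simp [contr, Finset.smul_sum, smul_comm z]
  | _ + 1, _, [], _ => by simp [contr]
  | p + 1, ℓ, x :: w, g => contr_smul κ z p _ w g

theorem Multi.swapAt {ℓ : List V → G → M} (h : Multi ℓ) (p : ℕ) :
    Multi fun w => ℓ (swapAt p w) := by
  induction p generalizing ℓ with
  | zero =>
    intro u v g
    match u, v with
    | [], [] => exact h [] [] g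
    | [], y :: v => exact h [y] v g
    | [y], v => exact h [] (y :: v) g
    | y :: z :: u, v => exact h (z :: y :: u) v g
  | succ p ih =>
    intro u v g
    match u with
    | [] => exact h [] _ g
    | y :: u => exact ih (h.cons y) u v g

theorem Multi.contr {ℓ : List V → G → M} (h : Multi ℓ) (κ : G → LinearMap.BilinForm ℂ V) (p : ℕ) :
    Multi (contr κ p ℓ) := by
  induction p generalizing ℓ with
  | zero =>
    intro u v g
    match u, v with
    | [], [] => exact isLinearMap_zero
    | [], y :: v =>
      refine isLinearMap_sum _ fun k => ?_
      exact ((LinearMap.toSpanSingleton ℂ M _) ∘ₗ ((κ k).flip y)).isLinear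
    | [y], v =>
      refine isLinearMap_sum _ fun k => ?_
      exact ((LinearMap.toSpanSingleton ℂ M _) ∘ₗ (κ k y)).isLinear
    | y :: z :: u, v =>
      refine isLinearMap_sum _ fun k => isLinearMap_smul _ ?_
      have := h (u.map (k • ·)) (v.map (k • ·)) (k * g)
      convert ((this.mk' _).comp (DistribSMul.toLinearMap ℂ V k)).isLinear using 2
      simp
  | succ p ih =>
    intro u v g
    match u with
    | [] =>
      constructor
      · intro x y
        change SymplecticReflection.contr κ p (fun w' => ℓ ((x + y) :: w')) v g = _
        rw [show (fun w' => ℓ ((x + y) :: w')) = (fun w' => ℓ (x :: w')) + fun w' => ℓ (y :: w') from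
          funext fun w' => funext fun g => (h [] w' g).map_add x y, contr_add]
        rfl
      · intro c x
        change SymplecticReflection.contr κ p (fun w' => ℓ ((c • x) :: w')) v g = _
        rw [show (fun w' => ℓ ((c • x) :: w')) = c • (fun w' => ℓ (x :: w')) from
          funext fun w' => funext fun g => (h [] w' g).map_smul c x, contr_smul]
        rfl
    | y :: u => exact ih (h.cons y) u v g

end Words

/-! ### Solving the commutation relations one word length at a time. -/

section Normal

variable {G V M : Type*} [Group G] [Fintype G] [AddCommGroup V] [Module ℂ V]
  [DistribMulAction G V] [SMulCommClass G ℂ V] [AddCommGroup M] [Module ℂ M]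

/-- The affine operators on functions of words whose common fixed points satisfy the relations
for words of length `n`. -/
def step (κ : G → LinearMap.BilinForm ℂ V) (n : ℕ) (ℓ₀ : List V → G → M) (p : ℕ)
    (ℓ : List V → G → M) : List V → G → M := fun w g =>
  if w.length = n then ℓ (swapAt p w) g + contr κ p ℓ₀ w g else ℓ w g

/-- The conditions on the right hand sides of the commutation relations that make the algebra
flat. -/
structure IsFlatBracket (κ : G → LinearMap.BilinForm ℂ V) : Prop where
  alt : ∀ k x, κ k x x = 0
  conj : ∀ g k x y, κ (g * k * g⁻¹) (g • x) (g • y) = κ k x y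
  jacobi : ∀ k x y z, κ k x y • (z - k • z) + κ k y z • (x - k • x) + κ k z x • (y - k • y) = 0

variable {κ : G → LinearMap.BilinForm ℂ V}

theorem IsFlatBracket.neg (hκ : IsFlatBracket κ) (k : G) (x y : V) : κ k y x = -κ k x y := by
  have h := hκ.alt k (x + y)
  simp only [map_add, LinearMap.add_apply, hκ.alt, zero_add, add_zero] at h
  exact eq_neg_of_add_eq_zero_left h

variable {n : ℕ} {ℓ₀ : List V → G → M}

theorem step_append (ℓ : List V → G → M) (u v : List V) (x y : V) (g : G)
    (h : (u ++ x :: y :: v).length = n) :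
    step κ n ℓ₀ u.length ℓ (u ++ x :: y :: v) g =
      ℓ (u ++ y :: x :: v) g + ∑ k, κ k x y • ℓ₀ (u ++ v.map (k • ·)) (k * g) := by
  rw [step, if_pos h, swapAt_append, contr_append]

theorem step_of_ne (ℓ : List V → G → M) {w : List V} {p : ℕ} (h : w.length ≠ n) :
    step κ n ℓ₀ p ℓ w = ℓ w := by
  funext g
  rw [step, if_neg h]

theorem step_step (hκ : IsFlatBracket κ) (p : ℕ) (hp : p + 2 ≤ n) (ℓ : List V → G → M) :
    step κ n ℓ₀ p (step κ n ℓ₀ p ℓ) = ℓ := by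
  funext w g
  by_cases hw : w.length = n
  · obtain ⟨u, x, y, v, rfl, rfl⟩ := exists_eq_append_two p w (by omega)
    have hw' : (u ++ y :: x :: v).length = n := by simpa using hw
    rw [step_append _ _ _ _ _ _ hw, step_append _ _ _ _ _ _ hw', add_assoc,
      ← Finset.sum_add_distrib, Finset.sum_eq_zero, add_zero]
    intro k _
    rw [hκ.neg k x y, neg_smul, neg_add_cancel]
  · rw [step_of_ne _ hw, step_of_ne _ hw]

/-- The two orders differ by commutators inside words that have already been contracted once. These
are shorter, so the relations for `ℓ₀` apply and turn both differences into double contractions. -/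
theorem step_comm (hκ : IsFlatBracket κ) (hℓ₀ : WordRel κ n ℓ₀) (p q : ℕ) (hpq : p + 2 ≤ q)
    (hq : q + 2 ≤ n) (ℓ : List V → G → M) :
    step κ n ℓ₀ p (step κ n ℓ₀ q ℓ) = step κ n ℓ₀ q (step κ n ℓ₀ p ℓ) := by
  funext w g
  by_cases hw : w.length = n
  · obtain ⟨u, x, y, v, rfl, rfl⟩ := exists_eq_append_two p w (by omega)
    obtain ⟨m, x', y', v, hm, rfl⟩ := exists_eq_append_two (q - u.length - 2) v (by
      simp at hw; omega)
    have h1 (a b : V) : u ++ a :: b :: (m ++ x' :: y' :: v) =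
      (u ++ a :: b :: m) ++ x' :: y' :: v := by simp
    have h1' (a b : V) : u ++ a :: b :: (m ++ y' :: x' :: v) =
      (u ++ a :: b :: m) ++ y' :: x' :: v := by simp
    have hlen (a b a' b' : V) : (u ++ a :: b :: (m ++ a' :: b' :: v)).length = n := by
      simpa using hw
    have hlen' (a b a' b' : V) : ((u ++ a :: b :: m) ++ a' :: b' :: v).length = n := by
      simpa using hw
    have hq' (a b : V) : q = (u ++ a :: b :: m).length := by simp; omega
    rw [step_append _ _ _ _ _ _ hw, h1 y x, hq' y x, step_append _ _ _ _ _ _ (hlen' _ _ _ _),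
      ← hq' y x, h1 x y, hq' x y, step_append _ _ _ _ _ _ (hlen' _ _ _ _), ← h1' x y,
      step_append _ _ _ _ _ _ (hlen _ _ _ _), ← h1' y x]
    rw [add_assoc, add_assoc, add_right_inj]
    refine (add_comm _ _).trans (Eq.trans (sub_eq_sub_iff_add_eq_add.1 ?_) (add_comm _ _))
    rw [← Finset.sum_sub_distrib, ← Finset.sum_sub_distrib]
    have hn : u.length + 2 + m.length + 2 + v.length = n := by simp at hw; omega
    have e2 : ∀ k, κ k x y • ℓ₀ (u ++ (m ++ x' :: y' :: v).map (k • ·)) (k * g) -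
        κ k x y • ℓ₀ (u ++ (m ++ y' :: x' :: v).map (k • ·)) (k * g) =
        ∑ j, (κ k x y * κ j (k • x') (k • y')) •
          ℓ₀ (u ++ m.map (k • ·) ++ v.map ((j * k) • ·)) (j * k * g) := by
      intro k
      have := hℓ₀ (u ++ m.map (k • ·)) (k • x') (k • y') (v.map (k • ·)) (k * g)
        (by simp; omega)
      rw [← smul_sub]
      simp only [List.map_append, List.map_cons, ← List.append_assoc] at this ⊢
      rw [this, Finset.smul_sum]
      simp [smul_smul, mul_assoc, Function.comp_def]
    have e3 : ∀ j, κ j x' y' • ℓ₀ (u ++ x :: y :: m ++ v.map (j • ·)) (j * g) -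
        κ j x' y' • ℓ₀ (u ++ y :: x :: m ++ v.map (j • ·)) (j * g) =
        ∑ k, (κ k x y * κ j x' y') •
          ℓ₀ (u ++ m.map (k • ·) ++ v.map ((k * j) • ·)) (k * j * g) := by
      intro j
      have := hℓ₀ u x y (m ++ v.map (j • ·)) (j * g) (by simp; omega)
      rw [← smul_sub]
      simp only [List.append_assoc, List.cons_append] at this ⊢
      rw [this, Finset.smul_sum]
      simp [smul_smul, mul_assoc, Function.comp_def, mul_comm (κ j x' y')]
    rw [Finset.sum_congr rfl fun k _ => e2 k, Finset.sum_congr rfl fun k _ => e3 k]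
    refine Eq.trans ?_ Finset.sum_comm
    refine Finset.sum_congr rfl fun k _ => ?_
    -- In one double sum `k` has been moved past `x'` and `y'`, in the other it has not.
    -- Equivariance of `κ` matches them under `j ↦ k j k⁻¹`.
    refine (Fintype.sum_equiv (MulAut.conj k).toEquiv _ _ fun j => ?_).symm
    simp only [MulEquiv.toEquiv_eq_coe, EquivLike.coe_coe, MulAut.conj_apply, hκ.conj]
    simp
  · rw [step_of_ne _ hw, step_of_ne _ hw, step_of_ne _ hw, step_of_ne _ hw]

theorem step_braid (hκ : IsFlatBracket κ) (hℓ₀ : Multi ℓ₀) (p : ℕ)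
    (hp : p + 3 ≤ n) (ℓ : List V → G → M) :
    step κ n ℓ₀ p (step κ n ℓ₀ (p + 1) (step κ n ℓ₀ p ℓ)) =
      step κ n ℓ₀ (p + 1) (step κ n ℓ₀ p (step κ n ℓ₀ (p + 1) ℓ)) := by
  funext w g
  by_cases hw : w.length = n
  · obtain ⟨u, x, y, z, v, rfl, rfl⟩ := exists_eq_append_three p w (by omega)
    have hlen (a b c : V) : (u ++ a :: b :: c :: v).length = n := by simpa using hw
    have s0 (ℓ : List V → G → M) (a b c : V) := step_append (κ := κ) (ℓ₀ := ℓ₀) ℓ u (c :: v) a b g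
      (hlen a b c)
    have s1 (ℓ : List V → G → M) (a b c : V) := step_append (κ := κ) (ℓ₀ := ℓ₀) ℓ (u ++ [a]) v b c g
      (by simpa using hw)
    simp only [List.append_assoc, List.cons_append, List.nil_append, List.length_append,
      List.length_cons, List.length_nil, zero_add] at s1
    rw [s0, s1, s0, s1, s0, s1]
    simp only [add_assoc, add_right_inj, ← Finset.sum_add_distrib]
    refine Finset.sum_congr rfl fun k _ => ?_
    -- For each `k`, the difference of the two sides is `ℓ₀` of a word with one distinguished
    -- letter, and that letter is the Jacobi expression up to sign.
    rw [← sub_eq_zero]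
    let f : V →ₗ[ℂ] M := (hℓ₀ u (v.map (k • ·)) (k * g)).mk' _
    have hf : ∀ a : V, ℓ₀ (u ++ a :: v.map (k • ·)) (k * g) = f a := fun a => rfl
    simp only [List.map_cons, hf]
    have h := congrArg f (hκ.jacobi k x y z)
    rw [hκ.neg k x z] at h
    simp only [map_add, map_smul, map_sub, map_zero] at h
    rw [← neg_eq_zero, ← h]
    module
  · rw [step_of_ne _ hw, step_of_ne _ hw, step_of_ne _ hw, step_of_ne _ hw, step_of_ne _ hw,
      step_of_ne _ hw]

variable {D : ℕ → Submodule ℂ M} {top : List V → G → M}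

/-- If the relations hold for words of length less than `n`, they can be made to hold for words
of length `n` as well. -/
theorem exists_wordRel_succ (hκ : IsFlatBracket κ) (hD : Monotone D)
    (hswap : ∀ p w, top (swapAt p w) = top w) (htopD : ∀ w g, top w g ∈ D (w.length + 1))
    (hm : Multi ℓ₀) (hl : ∀ w g, ℓ₀ w g - top w g ∈ D w.length) (hr : WordRel κ n ℓ₀) :
    ∃ ℓ : List V → G → M, Multi ℓ ∧ (∀ w g, ℓ w g - top w g ∈ D w.length) ∧
      WordRel κ (n + 1) ℓ ∧ ∀ w, w.length < n → ℓ w = ℓ₀ w := by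
  classical
  let Q : (List V → G → M) → Prop := fun ℓ => Multi ℓ ∧ (∀ w g, ℓ w g - top w g ∈ D w.length) ∧
    ∀ w, w.length ≠ n → ℓ w = ℓ₀ w
  -- A contraction removes two letters, so even the leading term of what remains lies in `D
  -- w.length`.
  have hcontr : ∀ p w g, contr κ p ℓ₀ w g ∈ D w.length := by
    intro p w g
    by_cases hp : p + 2 ≤ w.length
    · obtain ⟨u, x, y, v, rfl, rfl⟩ := exists_eq_append_two p w hp
      rw [contr_append]
      refine Submodule.sum_mem _ fun k _ => Submodule.smul_mem _ _ ?_
      rw [← sub_add_cancel (ℓ₀ _ _) (top (u ++ v.map (k • ·)) (k * g))]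
      refine Submodule.add_mem _ (hD ?_ (hl _ _)) (hD ?_ (htopD _ _)) <;>
        (simp only [List.length_append, List.length_cons, List.length_map]; omega)
    · have : contr κ p ℓ₀ w g = 0 := by
        clear hl hr hm
        induction p generalizing ℓ₀ w with
        | zero =>
          match w, hp with
          | [], _ => rfl
          | [_], _ => rfl
          | _ :: _ :: _, hp => simp at hp
        | succ p ih =>
          match w, hp with
          | [], _ => rfl
          | x :: w, hp => exact ih w (by simp at hp; omega)
      rw [this]
      exact Submodule.zero_mem _
  have hQ : ∀ p, p < n - 1 → ∀ ℓ, Q ℓ → Q (step κ n ℓ₀ p ℓ) := by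
    rintro p - ℓ ⟨h1, h2, h3⟩
    refine ⟨fun u v g => ?_, fun w g => ?_, fun w hw => by rw [step_of_ne _ hw, h3 w hw]⟩
    · by_cases h : (u ++ (0 : V) :: v).length = n
      · have h' : ∀ x : V, (u ++ x :: v).length = n := fun x => by simpa using h
        simp only [step, if_pos (h' _)]
        exact isLinearMap_add (h1.swapAt p u v g) (hm.contr κ p u v g)
      · have h' : ∀ x : V, (u ++ x :: v).length ≠ n := fun x => by simpa using h
        simp only [step, if_neg (h' _)]
        exact h1 u v g
    · by_cases hw : w.length = n
      · rw [step, if_pos hw, add_sub_right_comm]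
        refine Submodule.add_mem _ ?_ (hcontr p w g)
        have := h2 (swapAt p w) g
        rwa [hswap, length_swapAt] at this
      · rw [step_of_ne _ hw]
        exact h2 w g
  -- A word of length `n` has `n - 1` adjacent pairs. Each operator is affine and permutes the
  -- finite set `O`, so the barycentre of `O` is fixed by all of them; it inherits the conditions in
  -- `Q`, which are stable under averaging.
  obtain ⟨O, hOfin, hO, hOQ, hOst⟩ := exists_finite_stable (step κ n ℓ₀) (n - 1)
    (fun p hp => step_step hκ p (by omega))
    (fun p q hpq hq => step_comm hκ hr p q hpq (by omega))
    (fun p hp => step_braid hκ hm p (by omega)) Q hQ ℓ₀ ⟨hm, hl, fun _ _ => rfl⟩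
  lift O to Finset (List V → G → M) using hOfin
  simp only [Finset.mem_coe] at hO hOQ hOst
  have hc : (O.card : ℂ) ≠ 0 := by
    exact_mod_cast (Finset.card_pos.2 ⟨ℓ₀, hO⟩).ne'
  let ℓ : List V → G → M := fun w g => (O.card : ℂ)⁻¹ • ∑ o ∈ O, o w g
  have hconst : ∀ m : M, (O.card : ℂ)⁻¹ • ∑ _o ∈ O, m = m := fun m => by
    rw [Finset.sum_const, ← Nat.cast_smul_eq_nsmul ℂ, smul_smul, inv_mul_cancel₀ hc, one_smul]
  refine ⟨ℓ, fun u v g => ?_, fun w g => ?_, ?_, fun w hw => ?_⟩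
  · refine isLinearMap_smul _ ?_
    have : (fun x => ∑ o ∈ O, o (u ++ x :: v) g) =
        fun x => ∑ o : O, (o : List V → G → M) (u ++ x :: v) g :=
      funext fun x => (Finset.sum_coe_sort O fun o => o (u ++ x :: v) g).symm
    rw [this]
    exact isLinearMap_sum _ fun o => (hOQ o o.2).1 u v g
  · have : ℓ w g - top w g = (O.card : ℂ)⁻¹ • ∑ o ∈ O, (o w g - top w g) := by
      rw [Finset.sum_sub_distrib, smul_sub, hconst]
    rw [this]
    exact Submodule.smul_mem _ _ (Submodule.sum_mem _ fun o ho => (hOQ o ho).2.1 w g)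
  · have hfix : ∀ p, p < n - 1 → ∀ w g, w.length = n →
        ℓ w g = ℓ (swapAt p w) g + contr κ p ℓ₀ w g := by
      intro p hp w g hw
      have h1 : ∑ o ∈ O, o w g = ∑ o ∈ O, step κ n ℓ₀ p o w g := by
        refine (Finset.sum_nbij' (step κ n ℓ₀ p) (step κ n ℓ₀ p) (fun o ho => hOst p hp o ho)
          (fun o ho => hOst p hp o ho) (fun o _ => step_step hκ p (by omega) o)
          (fun o _ => step_step hκ p (by omega) o) fun o _ => rfl).symm
      simp only [ℓ]
      rw [h1]
      simp only [step, if_pos hw]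
      rw [Finset.sum_add_distrib, smul_add, hconst]
    have hlow : ∀ w, w.length < n → ℓ w = ℓ₀ w := by
      intro w hw
      funext g
      simp only [ℓ]
      rw [Finset.sum_congr rfl fun o ho => congrFun ((hOQ o ho).2.2 w hw.ne) g, hconst]
    intro u x y v g h
    by_cases hn : u.length + 2 + v.length < n
    · rw [hlow _ (by simp; omega), hlow _ (by simp; omega), hr u x y v g hn]
      refine Finset.sum_congr rfl fun k _ => ?_
      rw [hlow _ (by simp; omega)]
    · rw [hfix u.length (by omega) (u ++ x :: y :: v) g (by simp; omega), swapAt_append,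
        add_sub_cancel_left, contr_append]
      refine Finset.sum_congr rfl fun k _ => ?_
      rw [hlow _ (by simp; omega)]
  · funext g
    simp only [ℓ]
    rw [Finset.sum_congr rfl fun o ho => congrFun ((hOQ o ho).2.2 w hw.ne) g, hconst]

/-- There is a multilinear function of words satisfying all relations, with a prescribed
symmetric leading term. -/
theorem exists_wordRel (hκ : IsFlatBracket κ) (hD : Monotone D) (htop : Multi top)
    (hswap : ∀ p w, top (swapAt p w) = top w) (htopD : ∀ w g, top w g ∈ D (w.length + 1)) :
    ∃ ℓ : List V → G → M, Multi ℓ ∧ (∀ w g, ℓ w g - top w g ∈ D w.length) ∧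
      ∀ n, WordRel κ n ℓ := by
  let S (n : ℕ) := {ℓ : List V → G → M // Multi ℓ ∧ (∀ w g, ℓ w g - top w g ∈ D w.length) ∧
    WordRel κ n ℓ}
  have hS : ∀ n (s : S n), ∃ s' : S (n + 1), ∀ w, w.length < n → s'.1 w = s.1 w := fun n s => by
    obtain ⟨ℓ, h1, h2, h3, h4⟩ := exists_wordRel_succ hκ hD hswap htopD s.2.1 s.2.2.1 s.2.2.2
    exact ⟨⟨ℓ, h1, h2, h3⟩, h4⟩
  choose next hnext using hS
  -- At stage `0` there are no relations to satisfy, so `top` itself is admissible. The value on a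
  -- word is unchanged from stage `w.length + 1` on, which gives the limit.
  let s : ∀ n, S n := fun n => Nat.rec
    ⟨top, htop, fun w g => by rw [sub_self]; exact Submodule.zero_mem _,
      fun u x y v g h => absurd h (Nat.not_lt_zero _)⟩ next n
  have hs : ∀ n m, ∀ w : List V, w.length < n → (s (n + m)).1 w = (s n).1 w := by
    intro n m w hw
    induction m with
    | zero => rfl
    | succ m ih => exact (hnext (n + m) (s (n + m)) w (by omega)).trans ih
  let ℓ : List V → G → M := fun w => (s (w.length + 1)).1 w
  have hℓ : ∀ n (w : List V), w.length < n → ℓ w = (s n).1 w := by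
    intro n w hw
    obtain ⟨m, rfl⟩ : ∃ m, n = w.length + 1 + m := ⟨n - (w.length + 1), by omega⟩
    exact (hs (w.length + 1) m w (by omega)).symm
  refine ⟨ℓ, fun u v g => ?_, fun w g => (s (w.length + 1)).2.2.1 w g, fun n u x y v g h => ?_⟩
  · have : ∀ x, ℓ (u ++ x :: v) = (s (u.length + v.length + 2)).1 (u ++ x :: v) := fun x =>
      hℓ (u.length + v.length + 2) _ (by simp; omega)
    have e : (fun x => ℓ (u ++ x :: v) g) =
        fun x => (s (u.length + v.length + 2)).1 (u ++ x :: v) g :=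
      funext fun x => congrFun (this x) g
    rw [e]
    exact (s (u.length + v.length + 2)).2.1 u v g
  · rw [hℓ n _ (by simp; omega), hℓ n _ (by simp; omega), (s n).2.2.2 u x y v g h]
    refine Finset.sum_congr rfl fun k _ => ?_
    rw [hℓ n _ (by simp; omega)]

end Normal

/-! ### The structure constants of the symplectic reflection algebra. -/

section Coupling

variable {G V : Type*} [Group G] [Fintype G] [AddCommGroup V] [Module ℂ V]
  [FiniteDimensional ℂ V] [DistribMulAction G V] [SMulCommClass G ℂ V]

theorem oneSub_apply (g : G) (x : V) : oneSub V g x = x - g • x := rfl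

theorem mem_ker_oneSub {g : G} {x : V} : x ∈ LinearMap.ker (oneSub V g) ↔ g • x = x := by
  rw [LinearMap.mem_ker, oneSub_apply, sub_eq_zero, eq_comm]

/-- The projection to the image of `1 - g` along its kernel. -/
abbrev reflProj (g : G) : V →ₗ[ℂ] V := Submodule.projection _ _ (isCompl_oneSub V g)

theorem reflForm_apply (ω : LinearMap.BilinForm ℂ V) (g : G) (x y : V) :
    reflForm ω g x y = ω (reflProj g x) (reflProj g y) := rfl

theorem reflProj_mem (g : G) (x : V) : reflProj g x ∈ LinearMap.range (oneSub V g) :=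
  Submodule.projection_apply_mem _ x

theorem sub_reflProj_mem (g : G) (x : V) : x - reflProj g x ∈ LinearMap.ker (oneSub V g) := by
  rw [← Submodule.projection_apply_eq_zero_iff (isCompl_oneSub V g), map_sub,
    Submodule.projection_apply_of_mem_left _ (reflProj_mem g x), sub_self]

theorem reflProj_conj (g k : G) (x : V) : reflProj (g * k * g⁻¹) (g • x) = g • reflProj k x := by
  have h : g • x = g • reflProj k x + g • (x - reflProj k x) := by
    rw [← smul_add, add_sub_cancel]
  rw [h, map_add]
  have h1 : g • reflProj k x ∈ LinearMap.range (oneSub V (g * k * g⁻¹)) := by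
    obtain ⟨y, hy⟩ := reflProj_mem k x
    rw [← hy]
    exact ⟨g • y, by simp [oneSub_apply, smul_sub, smul_smul, mul_assoc]⟩
  have h2 : g • (x - reflProj k x) ∈ LinearMap.ker (oneSub V (g * k * g⁻¹)) := by
    have := mem_ker_oneSub.1 (sub_reflProj_mem k x)
    rw [mem_ker_oneSub, smul_smul, inv_mul_cancel_right, mul_smul, this]
  rw [Submodule.projection_apply_of_mem_left _ h1,
    (Submodule.projection_apply_eq_zero_iff _).2 h2, add_zero]

theorem oneSub_reflProj (g : G) (x : V) : oneSub V g (reflProj g x) = x - g • x := by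
  have := sub_reflProj_mem g x
  rw [LinearMap.mem_ker, map_sub, sub_eq_zero] at this
  exact this.symm

theorem one_notMem_reflections : (1 : G) ∉ reflections G V := by
  intro h
  have h0 : oneSub V (1 : G) = 0 := by ext x; simp [oneSub_apply]
  have h' : Module.finrank ℂ (LinearMap.range (oneSub V (1 : G))) = 2 := h
  rw [h0, LinearMap.range_zero, finrank_bot] at h'
  omega

theorem finrank_range_conj (g k : G) : Module.finrank ℂ (LinearMap.range (oneSub V (g * k * g⁻¹))) =
    Module.finrank ℂ (LinearMap.range (oneSub V k)) := by
  let e : V ≃ₗ[ℂ] V := DistribMulAction.toLinearEquiv ℂ V g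
  have h : LinearMap.range (oneSub V (g * k * g⁻¹)) =
      (LinearMap.range (oneSub V k)).map (e : V →ₗ[ℂ] V) := by
    ext x
    simp only [LinearMap.mem_range, Submodule.mem_map, exists_exists_eq_and]
    constructor
    · rintro ⟨y, rfl⟩
      exact ⟨g⁻¹ • y, by simp [e, oneSub_apply, smul_sub, smul_smul, mul_assoc]⟩
    · rintro ⟨y, rfl⟩
      exact ⟨g • y, by simp [e, oneSub_apply, smul_sub, smul_smul, mul_assoc]⟩
  rw [h]
  exact LinearEquiv.finrank_map_eq e _

theorem conj_mem_reflections_iff (g k : G) : g * k * g⁻¹ ∈ reflections G V ↔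
    k ∈ reflections G V := by
  simp only [reflections, Set.mem_ofPred_eq, finrank_range_conj]

variable (ω : LinearMap.BilinForm ℂ V) (t : ℂ) (c : reflections G V → ℂ)

open Classical in
/-- The coefficient of `k` in the commutator of two vectors in `H_{t,c}`. -/
def coupling (k : G) : LinearMap.BilinForm ℂ V :=
  if h : k ∈ reflections G V then (-2 * c ⟨k, h⟩) • reflForm ω k else if k = 1 then t • ω else 0

theorem coupling_one : coupling ω t c 1 = t • ω := by
  rw [coupling, dif_neg one_notMem_reflections, if_pos rfl]

/-- The cyclic sum is alternating in three vectors of a plane. This is where the rank 2 of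
symplectic reflections enters the Jacobi identity. -/
theorem alternating_rank_two (hω : ω.IsAlt) {R : Submodule ℂ V} (hR : Module.finrank ℂ R = 2)
    {a b d : V} (ha : a ∈ R) (hb : b ∈ R) (hd : d ∈ R) :
    ω a b • d + ω b d • a + ω d a • b = 0 := by
  let e := Module.finBasisOfFinrankEq ℂ R hR
  have key : ∀ x ∈ R, ∃ p q : ℂ, x = p • (e 0 : V) + q • (e 1 : V) := by
    intro x hx
    have := congrArg Subtype.val (e.sum_repr ⟨x, hx⟩)
    rw [Fin.sum_univ_two] at this
    exact ⟨_, _, this.symm⟩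
  obtain ⟨a0, a1, rfl⟩ := key a ha
  obtain ⟨b0, b1, rfl⟩ := key b hb
  obtain ⟨d0, d1, rfl⟩ := key d hd
  have h0 : ∀ x, ω x x = 0 := hω
  have h1 : ω (e 1 : V) (e 0 : V) = -ω (e 0 : V) (e 1 : V) := by
    have := h0 ((e 0 : V) + (e 1 : V))
    simp only [map_add, LinearMap.add_apply, h0] at this
    linear_combination this
  simp only [map_add, map_smul, LinearMap.add_apply, LinearMap.smul_apply, h0, h1, smul_eq_mul]
  module

/-- For a reflection `k`, the Jacobi identity is the rank-two identity for the projections with `1 -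
k` applied, since `1 - k` kills the complementary components. For `k = 1` each `z - k • z` is zero.
-/
theorem isFlatBracket_coupling (hω : ω.IsAlt)
    (hinv : ∀ (g : G) (x y : V), ω (g • x) (g • y) = ω x y)
    (hc : ∀ s s' : reflections G V, IsConj (s : G) (s' : G) → c s = c s') :
    IsFlatBracket (coupling ω t c) where
  alt k x := by
    have h0 : ∀ x, ω x x = 0 := hω
    unfold coupling
    split_ifs <;> simp [reflForm_apply, h0]
  conj g k x y := by
    by_cases h : k ∈ reflections G V
    · have h' := (conj_mem_reflections_iff g k).2 h
      rw [coupling, coupling, dif_pos h, dif_pos h', hc ⟨_, h'⟩ ⟨k, h⟩ (isConj_iff.2 ⟨g, rfl⟩).symm]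
      simp only [LinearMap.smul_apply, reflForm_apply, reflProj_conj, hinv]
    · have h' := mt (conj_mem_reflections_iff g k).1 h
      have h1 : g * k * g⁻¹ = 1 ↔ k = 1 := conj_eq_one_iff
      by_cases hk : k = 1
      · rw [coupling, coupling, dif_neg h, dif_neg h', if_pos hk, if_pos (h1.2 hk)]
        simp [hinv]
      · rw [coupling, coupling, dif_neg h, dif_neg h', if_neg hk, if_neg (mt h1.1 hk)]
        simp
  jacobi k x y z := by
    by_cases h : k ∈ reflections G V
    · have hR : Module.finrank ℂ (LinearMap.range (oneSub V k)) = 2 := h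
      have key := alternating_rank_two ω hω hR (reflProj_mem k x) (reflProj_mem k y)
        (reflProj_mem k z)
      have := congrArg (fun v => (-2 * c ⟨k, h⟩) • oneSub V k v) key
      simp only [map_add, map_smul, oneSub_reflProj, map_zero, smul_zero, smul_add] at this
      simpa only [coupling, dif_pos h, LinearMap.smul_apply, reflForm_apply, smul_eq_mul, mul_smul]
        using this
    · by_cases h1 : k = 1
      · simp [h1]
      · simp [coupling, dif_neg h, if_neg h1]

/-- For `g ≠ 1` the image of `1 - g` is not isotropic. -/
theorem exists_oneSub_ne_zero [FaithfulSMul G V] (hω : ω.Nondegenerate)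
    (hinv : ∀ (g : G) (x y : V), ω (g • x) (g • y) = ω x y) {g : G} (hg : g ≠ 1) :
    ∃ x y, ω (x - g • x) (y - g • y) ≠ 0 := by
  by_contra! h
  refine hg (FaithfulSMul.eq_of_smul_eq_smul (α := V) fun x => ?_)
  rw [one_smul, eq_comm, ← sub_eq_zero]
  refine hω.1 _ fun v => ?_
  obtain ⟨r, hr⟩ := reflProj_mem g v
  have hr' : ω (x - g • x) (reflProj g v) = 0 := by rw [← hr, oneSub_apply, h]
  -- Split `v` along image and kernel of `1 - g`. The image part pairs to zero by assumption, the
  -- kernel part because `g` fixes it and preserves `ω`.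
  rw [← add_sub_cancel (reflProj g v) v, map_add, hr', zero_add]
  have hk := mem_ker_oneSub.1 (sub_reflProj_mem g v)
  rw [LinearMap.map_sub₂, sub_eq_zero, ← hinv g x, hk]

end Coupling

/-! ### The action by right translation on functions satisfying the relations. -/

section Representation

variable {G V M : Type*} [Group G] [Fintype G] [AddCommGroup V] [Module ℂ V]
  [DistribMulAction G V] [SMulCommClass G ℂ V] [AddCommGroup M] [Module ℂ M]

/-- The multilinear functions of words satisfying all commutation relations. -/
def relSpace (κ : G → LinearMap.BilinForm ℂ V) (M : Type*) [AddCommGroup M] [Module ℂ M] :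
    Submodule ℂ (List V → G → M) where
  carrier := {ℓ | Multi ℓ ∧ ∀ n, WordRel κ n ℓ}
  zero_mem' := ⟨fun _ _ _ => isLinearMap_zero, fun n u x y v g _ => by simp⟩
  add_mem' := by
    rintro ℓ ℓ' ⟨h1, h2⟩ ⟨h1', h2'⟩
    refine ⟨fun u v g => isLinearMap_add (h1 u v g) (h1' u v g), fun n u x y v g h => ?_⟩
    simp only [Pi.add_apply, smul_add, Finset.sum_add_distrib, ← h2 n u x y v g h,
      ← h2' n u x y v g h]
    abel
  smul_mem' := by
    rintro z ℓ ⟨h1, h2⟩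
    refine ⟨fun u v g => isLinearMap_smul z (h1 u v g), fun n u x y v g h => ?_⟩
    simp only [Pi.smul_apply, smul_comm _ z, ← Finset.smul_sum, ← h2 n u x y v g h, smul_sub]

variable {κ : G → LinearMap.BilinForm ℂ V}

theorem relSpace_rel (ℓ : relSpace κ M) (u : List V) (x y : V) (v : List V) (g : G) :
    ℓ.1 (u ++ x :: y :: v) g - ℓ.1 (u ++ y :: x :: v) g =
      ∑ k, κ k x y • ℓ.1 (u ++ v.map (k • ·)) (k * g) :=
  ℓ.2.2 (u.length + 2 + v.length + 1) u x y v g (Nat.lt_succ_self _)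

/-- Right translation by a group element. -/
def groupOp (κ : G → LinearMap.BilinForm ℂ V) (M : Type*) [AddCommGroup M] [Module ℂ M] :
    G →* Module.End ℂ (relSpace κ M) where
  toFun h :=
    { toFun := fun ℓ => ⟨fun w g => ℓ.1 w (g * h), fun u v g => ℓ.2.1 u v (g * h),
        fun n u x y v g hn => by simpa only [mul_assoc] using ℓ.2.2 n u x y v (g * h) hn⟩
      map_add' := fun _ _ => rfl
      map_smul' := fun _ _ => rfl }
  map_one' := by
    refine LinearMap.ext fun ℓ => Subtype.ext (funext fun w => funext fun g => ?_)
    exact congrArg (ℓ.1 w) (mul_one g)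
  map_mul' h h' := by
    refine LinearMap.ext fun ℓ => Subtype.ext (funext fun w => funext fun g => ?_)
    exact congrArg (ℓ.1 w) (mul_assoc g h h').symm

/-- Right translation by a vector. -/
def vecOp (κ : G → LinearMap.BilinForm ℂ V) (M : Type*) [AddCommGroup M] [Module ℂ M] :
    V →ₗ[ℂ] Module.End ℂ (relSpace κ M) where
  toFun x :=
    -- The pair `w`, `g` stands for the product `w g`, and `w g x = w (g • x) g`.
    { toFun := fun ℓ => ⟨fun w g => ℓ.1 (w ++ [g • x]) g,
        fun u v g => by simpa using ℓ.2.1 u (v ++ [g • x]) g,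
        fun n u a b v g hn => by
          have := relSpace_rel ℓ u a b (v ++ [g • x]) g
          simpa [mul_smul] using this⟩
      map_add' := fun _ _ => rfl
      map_smul' := fun _ _ => rfl }
  map_add' x y := by
    refine LinearMap.ext fun ℓ => Subtype.ext (funext fun w => funext fun g => ?_)
    change ℓ.1 (w ++ [g • (x + y)]) g = ℓ.1 (w ++ [g • x]) g + ℓ.1 (w ++ [g • y]) g
    rw [smul_add]
    exact (ℓ.2.1 w [] g).map_add _ _
  map_smul' z x := by
    refine LinearMap.ext fun ℓ => Subtype.ext (funext fun w => funext fun g => ?_)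
    change ℓ.1 (w ++ [g • z • x]) g = z • ℓ.1 (w ++ [g • x]) g
    rw [smul_comm]
    exact (ℓ.2.1 w [] g).map_smul _ _

theorem groupOp_mul_vecOp (g : G) (x : V) :
    vecOp κ M (g • x) * groupOp κ M g = groupOp κ M g * vecOp κ M x := by
  refine LinearMap.ext fun ℓ => Subtype.ext (funext fun w => funext fun h => ?_)
  change ℓ.1 (w ++ [h • g • x]) (h * g) = ℓ.1 (w ++ [(h * g) • x]) (h * g)
  rw [mul_smul]

theorem vecOp_comm (hκ : IsFlatBracket κ) (x y : V) :
    vecOp κ M x * vecOp κ M y - vecOp κ M y * vecOp κ M x = ∑ k, κ k x y • groupOp κ M k := by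
  refine LinearMap.ext fun ℓ => Subtype.ext (funext fun w => funext fun g => ?_)
  have h := relSpace_rel ℓ w (g • x) (g • y) [] g
  have e1 : ((vecOp κ M x * vecOp κ M y - vecOp κ M y * vecOp κ M x) ℓ).1 w g =
      ℓ.1 (w ++ [g • x] ++ [g • y]) g - ℓ.1 (w ++ [g • y] ++ [g • x]) g := rfl
  have e2 : ((∑ k, κ k x y • groupOp κ M k) ℓ).1 w g = ∑ k, κ k x y • ℓ.1 w (g * k) := by
    simp only [LinearMap.sum_apply, Submodule.coe_sum, Finset.sum_apply]
    rfl
  rw [e1, e2]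
  simp only [List.append_assoc, List.cons_append, List.nil_append, List.map_nil,
    List.append_nil] at h ⊢
  rw [h]
  refine (Fintype.sum_equiv (MulAut.conj g).toEquiv _ _ fun k => ?_).symm
  simp [hκ.conj]

end Representation

open MvPolynomial

/-! ### Symmetric products and the abstract PBW property. -/

section FlatAlgebra

variable {G V : Type*} [Group G] [Fintype G] [AddCommGroup V] [Module ℂ V]
  [DistribMulAction G V] [SMulCommClass G ℂ V]

/-- The inclusion of `V` into its symmetric algebra, in the coordinates of a basis. -/
def lin {σ : Type*} (b : Module.Basis σ ℂ V) : V →ₗ[ℂ] MvPolynomial σ ℂ := b.constr ℂ X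

theorem lin_basis {σ : Type*} (b : Module.Basis σ ℂ V) (i : σ) : lin b (b i) = X i :=
  b.constr_basis ℂ _ i

theorem isHomogeneous_lin {σ : Type*} (b : Module.Basis σ ℂ V) (x : V) :
    (lin b x).IsHomogeneous 1 := by
  rw [lin, Module.Basis.constr_apply]
  exact IsHomogeneous.sum _ _ _ fun i _ => by
    change (b.repr x i • X i : MvPolynomial σ ℂ).IsHomogeneous 1
    rw [smul_eq_C_mul]
    simpa using (isHomogeneous_X ℂ i).C_mul (b.repr x i)

/-- The symmetric product of the letters of a word. -/
def symProd {σ : Type*} (b : Module.Basis σ ℂ V) (w : List V) : MvPolynomial σ ℂ :=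
  (w.map (lin b)).prod

theorem isHomogeneous_symProd {σ : Type*} (b : Module.Basis σ ℂ V) (w : List V) :
    (symProd b w).IsHomogeneous w.length := by
  induction w with
  | nil => exact isHomogeneous_one _ _
  | cons x w ih =>
    rw [symProd, List.map_cons, List.prod_cons, List.length_cons, add_comm]
    exact (isHomogeneous_lin b x).mul ih

open Classical in
/-- An algebra generated by `V` and `G`, with commutators of vectors given by `κ`, together with a
normal form map whose leading terms are those of `S(V)`. -/
structure FlatAlgebra {σ : Type*} (b : Module.Basis σ ℂ V) (κ : G → LinearMap.BilinForm ℂ V)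
    (H : Type*) [Ring H] [Algebra ℂ H] where
  vec : V →ₗ[ℂ] H
  grp : G →* H
  grp_mul_vec : ∀ g x, grp g * vec x = vec (g • x) * grp g
  comm : ∀ x y, vec x * vec y - vec y * vec x = ∑ k, κ k x y • grp k
  span : Submodule.span ℂ {h | ∃ (w : List V) (g : G), h = (w.map vec).prod * grp g} = ⊤
  normal : H →ₗ[ℂ] MvPolynomial σ ℂ
  component_normal : ∀ (w : List V) (g : G) (k : ℕ), w.length ≤ k →
    homogeneousComponent k (normal ((w.map vec).prod * grp g)) =
      if k = w.length ∧ g = 1 then symProd b w else 0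

end FlatAlgebra

/-! ### Existence of a normal form with leading term the symmetric product. -/

section Normal

variable {G V : Type*} [Group G] [Fintype G] [AddCommGroup V] [Module ℂ V]
  [DistribMulAction G V] [SMulCommClass G ℂ V] {σ : Type*} (b : Module.Basis σ ℂ V)

theorem swapAt_perm {α : Type*} [AddCommGroup α] : ∀ (p : ℕ) (w : List α), (swapAt p w).Perm w
  | 0, [] => .refl _
  | 0, [_] => .refl _
  | 0, x :: y :: w => .swap x y w
  | _ + 1, [] => .refl _
  | p + 1, x :: w => (swapAt_perm p w).cons x

theorem multi_symProd : Multi fun w (_ : G) => symProd b w := by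
  intro u v _
  have : (fun x => symProd b (u ++ x :: v)) = fun x => (symProd b u * symProd b v) * lin b x := by
    funext x
    simp only [symProd, List.map_append, List.map_cons, List.prod_append, List.prod_cons]
    ring
  rw [this]
  exact (LinearMap.mulLeft ℂ _ ∘ₗ lin b).isLinear

/-- The polynomials of degree less than `n`. -/
def lowDegree (σ : Type*) (n : ℕ) : Submodule ℂ (MvPolynomial σ ℂ) where
  carrier := {f | ∀ k, n ≤ k → homogeneousComponent k f = 0}
  zero_mem' := fun k _ => map_zero _
  add_mem' := fun h h' k hk => by rw [map_add, h k hk, h' k hk, add_zero]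
  smul_mem' := fun z f h k hk => by rw [map_smul, h k hk, smul_zero]

open Classical in
theorem exists_normal {κ : G → LinearMap.BilinForm ℂ V} (hκ : IsFlatBracket κ) :
    ∃ ℓ : relSpace κ (MvPolynomial σ ℂ), ∀ (w : List V) (g : G) (k : ℕ), w.length ≤ k →
      homogeneousComponent k (ℓ.1 w g) = if k = w.length ∧ g = 1 then symProd b w else 0 := by
  obtain ⟨ℓ, h1, h2, h3⟩ := exists_wordRel (κ := κ) (D := lowDegree σ)
    (top := fun w g => if g = 1 then symProd b w else 0) hκ
    (fun m n h f hf k hk => hf k (h.trans hk))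
    (fun u v g => by
      change IsLinearMap ℂ fun x => if g = 1 then symProd b (u ++ x :: v) else 0
      split_ifs
      · exact multi_symProd b u v g
      · exact isLinearMap_zero)
    (fun p w => by
      funext g
      simp only [symProd, ((swapAt_perm p w).map (lin b)).prod_eq])
    (fun w g k hk => by
      split_ifs
      · rw [homogeneousComponent_of_mem (isHomogeneous_symProd b w), if_neg (by omega)]
      · exact map_zero _)
  refine ⟨⟨ℓ, h1, h3⟩, fun w g k hk => ?_⟩
  have := h2 w g k hk
  rw [map_sub, sub_eq_zero] at this
  rw [this]
  by_cases hg : g = 1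
  · simp only [hg, if_true, and_true]
    rw [homogeneousComponent_of_mem (isHomogeneous_symProd b w)]
  · simp [hg]

end Normal

/-! ### The PBW theorem for symplectic reflection algebras. -/

section Algebra

variable {G V : Type*} [Group G] [Fintype G] [AddCommGroup V] [Module ℂ V]
  [FiniteDimensional ℂ V] [DistribMulAction G V] [SMulCommClass G ℂ V]
  (ω : LinearMap.BilinForm ℂ V) (t : ℂ) (c : reflections G V → ℂ)

/-- The image of a vector in `H_{t,c}`. -/
def vecAlg : V →ₗ[ℂ] Alg ω t c :=
  (RingQuot.mkAlgHom ℂ (Rel ω t c)).toLinearMap ∘ₗ SkewMonoidAlgebra.lsingle ℂ 1 ∘ₗ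
    TensorAlgebra.ι ℂ

theorem vecAlg_apply (x : V) : vecAlg ω t c x = RingQuot.mkAlgHom ℂ (Rel ω t c) (vec x) := rfl

theorem grp_apply (g : G) : grp ω t c g =
    RingQuot.mkAlgHom ℂ (Rel ω t c) (SkewMonoidAlgebra.of (TensorAlgebra ℂ V) G g) := rfl

theorem grp_mul_vecAlg (g : G) (x : V) :
    grp ω t c g * vecAlg ω t c x = vecAlg ω t c (g • x) * grp ω t c g := by
  rw [vecAlg_apply, vecAlg_apply, grp_apply, ← map_mul, ← map_mul]
  congr 1
  simp only [vec, SkewMonoidAlgebra.of_apply, SkewMonoidAlgebra.single_mul_single, mul_one,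
    one_mul, one_smul, smul_tensor_def, tensorMap_ι]

/-- Passes between the uniform sum over `G` and the shape of the defining relation; used both in `H`
and in its representation. -/
theorem sum_coupling_smul {N : Type*} [AddCommGroup N] [Module ℂ N] (f : G → N) (x y : V)
    [Fintype (reflections G V)] :
    ∑ k, coupling ω t c k x y • f k = (t * ω x y) • f 1 -
      (2 : ℂ) • ∑ s : reflections G V, (c s * reflForm ω (s : G) x y) • f s := by
  classical
  have h : ∀ k, coupling ω t c k x y • f k =
      (if k = 1 then (t * ω x y) • f 1 else 0) +
        if h : k ∈ reflections G V then (-2 * c ⟨k, h⟩ * reflForm ω k x y) • f k else 0 := by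
    intro k
    by_cases hk : k ∈ reflections G V
    · have hk1 : k ≠ 1 := fun h => one_notMem_reflections (V := V) (h ▸ hk)
      rw [coupling, dif_pos hk, dif_pos hk, if_neg hk1, zero_add]
      rfl
    · by_cases hk1 : k = 1
      · subst hk1
        rw [coupling_one, dif_neg hk, if_pos rfl, add_zero]
        rfl
      · rw [coupling, dif_neg hk, dif_neg hk, if_neg hk1, if_neg hk1]
        simp
  rw [Finset.sum_congr rfl fun k _ => h k, Finset.sum_add_distrib, Finset.sum_ite_eq',
    if_pos (Finset.mem_univ _), sub_eq_add_neg, ← neg_smul, Finset.smul_sum]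
  congr 1
  refine (Fintype.sum_of_injective (fun s : reflections G V => (s : G)) Subtype.val_injective _ _
    (fun k hk => dif_neg fun h => hk ⟨⟨k, h⟩, rfl⟩) fun s => ?_).symm
  rw [dif_pos s.2, smul_smul, mul_assoc]

theorem vecAlg_comm (x y : V) : vecAlg ω t c x * vecAlg ω t c y - vecAlg ω t c y * vecAlg ω t c x =
    ∑ k, coupling ω t c k x y • grp ω t c k := by
  classical
  have := RingQuot.mkAlgHom_rel ℂ (Rel.comm (ω := ω) (t := t) (c := c) x y)
  simp only [map_sub, map_mul, map_sum, map_smul, AlgHom.commutes] at this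
  simp only [vecAlg_apply]
  refine this.trans (Eq.trans ?_ (sum_coupling_smul ω t c (fun k => grp ω t c k) x y).symm)
  rw [← map_mul, map_one, Algebra.algebraMap_eq_smul_one, map_ofNat, two_smul, two_mul]
  rfl

theorem span_words_eq_top :
    Submodule.span ℂ {h | ∃ (w : List V) (g : G), h = (w.map (vecAlg ω t c)).prod * grp ω t c g} = ⊤ := by
  rw [Submodule.eq_top_iff']
  intro h
  obtain ⟨a, rfl⟩ := RingQuot.mkAlgHom_surjective ℂ (Rel ω t c) h
  induction a using SkewMonoidAlgebra.induction_on' with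
  | add a a' h h' => rw [map_add]; exact Submodule.add_mem _ h h'
  | single g a =>
    have h1 : SkewMonoidAlgebra.single g a =
        SkewMonoidAlgebra.single 1 a * SkewMonoidAlgebra.of (TensorAlgebra ℂ V) G g := by
      simp [SkewMonoidAlgebra.of_apply, SkewMonoidAlgebra.single_mul_single]
    rw [h1, map_mul]
    clear h1
    change _ * grp ω t c g ∈ _
    have h2 : RingQuot.mkAlgHom ℂ (Rel ω t c) (SkewMonoidAlgebra.single 1 a) ∈
        Submodule.span ℂ (Set.range fun w : List V => (w.map (vecAlg ω t c)).prod) := by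
      induction a using TensorAlgebra.induction with
      | algebraMap r =>
        have : SkewMonoidAlgebra.single 1 (algebraMap ℂ (TensorAlgebra ℂ V) r) =
          algebraMap ℂ (SkewTensor G V) r := rfl
        rw [this, AlgHom.commutes, Algebra.algebraMap_eq_smul_one]
        exact Submodule.smul_mem _ _ (Submodule.subset_span ⟨[], rfl⟩)
      | ι x => exact Submodule.subset_span ⟨[x], by simp [vecAlg_apply, vec]⟩
      | mul a a' h h' =>
        have : SkewMonoidAlgebra.single 1 (a * a') =
            (SkewMonoidAlgebra.single 1 a * SkewMonoidAlgebra.single 1 a' : SkewTensor G V) := by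
          simp [SkewMonoidAlgebra.single_mul_single]
        rw [this, map_mul]
        have h3 := Submodule.mul_mem_mul h h'
        rw [Submodule.span_mul_span] at h3
        refine Submodule.span_mono ?_ h3
        rintro _ ⟨_, ⟨w, rfl⟩, _, ⟨w', rfl⟩, rfl⟩
        exact ⟨w ++ w', by simp⟩
      | add a a' h h' =>
        rw [SkewMonoidAlgebra.single_add, map_add]
        exact Submodule.add_mem _ h h'
    refine (Submodule.span_le (p := Submodule.comap (LinearMap.mulRight ℂ (grp ω t c g))
      (Submodule.span ℂ {h | ∃ (w : List V) (g : G), h = (w.map (vecAlg ω t c)).prod * grp ω t c g}))).2 ?_ h2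
    rintro _ ⟨w, rfl⟩
    exact Submodule.subset_span ⟨w, g, rfl⟩

variable {ω t c}

variable (ω t c) in
/-- The action of `ℂ[G] ⋉ T(V)` on functions of words. -/
def skewRep (M : Type*) [AddCommGroup M] [Module ℂ M] :
    SkewTensor G V →ₐ[ℂ] Module.End ℂ (relSpace (coupling ω t c) M) :=
  SkewMonoidAlgebra.liftNCAlgHom
    (TensorAlgebra.lift ℂ (vecOp (coupling ω t c) M)) (groupOp (coupling ω t c) M) (by
      intro a g
      induction a using TensorAlgebra.induction with
      | algebraMap r => rw [smul_algebraMap, AlgHom.commutes, Algebra.commutes]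
      | ι x =>
        rw [smul_tensor_def, tensorMap_ι, TensorAlgebra.lift_ι_apply, TensorAlgebra.lift_ι_apply,
          groupOp_mul_vecOp]
      | mul a a' h h' => rw [smul_mul', map_mul, map_mul, mul_assoc, h', ← mul_assoc, h, mul_assoc]
      | add a a' h h' => rw [smul_add, map_add, map_add, add_mul, mul_add, h, h'])

theorem skewRep_vec (M : Type*) [AddCommGroup M] [Module ℂ M] (x : V) :
    skewRep ω t c M (vec x : SkewTensor G V) = vecOp (coupling ω t c) M x := by
  change SkewMonoidAlgebra.liftNC _ _ (SkewMonoidAlgebra.single _ _) = _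
  rw [SkewMonoidAlgebra.liftNC_single]
  simp

theorem skewRep_of (M : Type*) [AddCommGroup M] [Module ℂ M] (g : G) :
    skewRep ω t c M (SkewMonoidAlgebra.of (TensorAlgebra ℂ V) G g) =
      groupOp (coupling ω t c) M g := by
  change SkewMonoidAlgebra.liftNC _ _ (SkewMonoidAlgebra.single _ _) = _
  rw [SkewMonoidAlgebra.liftNC_single]
  simp

theorem skewRep_rel (hκ : IsFlatBracket (coupling ω t c)) (M : Type*) [AddCommGroup M]
    [Module ℂ M] {a a' : SkewTensor G V} (h : Rel ω t c a a') :
    skewRep ω t c M a = skewRep ω t c M a' := by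
  classical
  obtain ⟨x, y⟩ := h
  simp only [map_sub, map_mul, map_sum, map_smul, AlgHom.commutes, skewRep_vec, skewRep_of]
  refine (vecOp_comm hκ x y).trans
    ((sum_coupling_smul ω t c (fun k => groupOp (coupling ω t c) M k) x y).trans ?_)
  rw [← map_mul, map_one, Algebra.algebraMap_eq_smul_one, map_ofNat, two_smul, two_mul]

/-- The action of `H_{t,c}` on functions of words. -/
def wordRep (hκ : IsFlatBracket (coupling ω t c)) (M : Type*) [AddCommGroup M] [Module ℂ M] :
    Alg ω t c →ₐ[ℂ] Module.End ℂ (relSpace (coupling ω t c) M) :=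
  RingQuot.liftAlgHom ℂ ⟨skewRep ω t c M, fun _ _ h => skewRep_rel hκ M h⟩

theorem wordRep_vecAlg (hκ : IsFlatBracket (coupling ω t c)) (M : Type*) [AddCommGroup M]
    [Module ℂ M] (x : V) : wordRep hκ M (vecAlg ω t c x) = vecOp (coupling ω t c) M x := by
  rw [vecAlg_apply, wordRep, RingQuot.liftAlgHom_mkAlgHom_apply, skewRep_vec]

theorem wordRep_grp (hκ : IsFlatBracket (coupling ω t c)) (M : Type*) [AddCommGroup M]
    [Module ℂ M] (g : G) : wordRep hκ M (grp ω t c g) = groupOp (coupling ω t c) M g := by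
  rw [grp_apply, wordRep, RingQuot.liftAlgHom_mkAlgHom_apply, skewRep_of]

theorem wordRep_word (hκ : IsFlatBracket (coupling ω t c)) {M : Type*} [AddCommGroup M]
    [Module ℂ M] (w u : List V) (ℓ : relSpace (coupling ω t c) M) :
    (wordRep hκ M (w.map (vecAlg ω t c)).prod ℓ).1 u 1 = ℓ.1 (u ++ w) 1 := by
  induction w generalizing u with
  | nil => simp
  | cons x w ih =>
    rw [List.map_cons, List.prod_cons, map_mul, wordRep_vecAlg]
    change (wordRep hκ M (w.map (vecAlg ω t c)).prod ℓ).1 (u ++ [(1 : G) • x]) 1 = _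
    rw [ih, one_smul, List.append_assoc]
    rfl

/-- The PBW property: `H_{t,c}` is flat. -/
theorem exists_flatAlgebra (hκ : IsFlatBracket (coupling ω t c)) {σ : Type*}
    (b : Module.Basis σ ℂ V) :
    ∃ F : FlatAlgebra b (coupling ω t c) (Alg ω t c), F.grp = grp ω t c := by
  obtain ⟨ℓ, hℓ⟩ := exists_normal b hκ
  refine ⟨{
    vec := vecAlg ω t c
    grp := grp ω t c
    grp_mul_vec := grp_mul_vecAlg ω t c
    comm := vecAlg_comm ω t c
    span := span_words_eq_top ω t c
    normal :=
      -- Translating `ℓ` by `w g` and evaluating at the empty word and `1` returns `ℓ` at `w`, `g`.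
      -- So `ℓ` descends to a linear map on `H`.
      { toFun := fun h => (wordRep hκ (MvPolynomial σ ℂ) h ℓ).1 [] 1
        map_add' := fun h h' => by rw [map_add]; rfl
        map_smul' := fun z h => by rw [map_smul]; rfl }
    component_normal := fun w g k hk => ?_ }, rfl⟩
  rw [← hℓ w g k hk]
  congr 1
  change (wordRep hκ _ _ ℓ).1 [] 1 = _
  rw [map_mul, Module.End.mul_apply, wordRep_word, wordRep_grp]
  change ℓ.1 ([] ++ w) (1 * g) = _
  rw [one_mul]
  rfl

end Algebra

/-! ### Components in integer degrees, so that shifts such as `m + n - d` are not truncated. -/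

section HComp

variable {σ : Type*}

/-- The homogeneous component of a polynomial in an integral degree. -/
def hcomp (z : ℤ) : MvPolynomial σ ℂ →ₗ[ℂ] MvPolynomial σ ℂ :=
  if 0 ≤ z then homogeneousComponent z.toNat else 0

theorem hcomp_natCast (n : ℕ) : hcomp (σ := σ) n = homogeneousComponent n := by
  rw [hcomp, if_pos (Int.natCast_nonneg n), Int.toNat_natCast]

theorem hcomp_of_neg {z : ℤ} (hz : z < 0) : hcomp (σ := σ) z = 0 := if_neg (by omega)

theorem homogeneousComponent_hcomp {z : ℤ} {k : ℕ} (h : (k : ℤ) ≠ z) (f : MvPolynomial σ ℂ) :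
    homogeneousComponent k (hcomp z f) = 0 := by
  rcases lt_or_ge z 0 with hz | hz
  · rw [hcomp_of_neg hz, LinearMap.zero_apply, map_zero]
  · obtain ⟨n, rfl⟩ := Int.eq_ofNat_of_zero_le hz
    rw [hcomp_natCast, homogeneousComponent_of_mem (homogeneousComponent_isHomogeneous n f),
      if_neg (by exact_mod_cast h)]

end HComp

namespace FlatAlgebra

variable {G V : Type*} [Group G] [Fintype G] [AddCommGroup V] [Module ℂ V]
  [DistribMulAction G V] [SMulCommClass G ℂ V] {σ : Type*} {b : Module.Basis σ ℂ V}
  {κ : G → LinearMap.BilinForm ℂ V} {H : Type*} [Ring H] [Algebra ℂ H] (F : FlatAlgebra b κ H)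

/-! ### The filtration by word length, with and without group elements. -/

section Words

/-- The product in `H` of the letters of a word. -/
def word (w : List V) : H := (w.map F.vec).prod

@[simp]
theorem word_nil : F.word [] = 1 := rfl

theorem word_cons (x : V) (w : List V) : F.word (x :: w) = F.vec x * F.word w := by
  simp [word]

theorem word_append (w w' : List V) : F.word (w ++ w') = F.word w * F.word w' := by
  simp [word]

theorem grp_mul_word (g : G) (w : List V) :
    F.grp g * F.word w = F.word (w.map (g • ·)) * F.grp g := by
  induction w with
  | nil => simp
  | cons x w ih =>
    rw [List.map_cons, word_cons, word_cons, ← mul_assoc, F.grp_mul_vec, mul_assoc, ih, mul_assoc]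

theorem word_mul_word (w w' : List V) (g g' : G) :
    F.word w * F.grp g * (F.word w' * F.grp g') =
      F.word (w ++ w'.map (g • ·)) * F.grp (g * g') := by
  rw [word_append, map_mul, mul_assoc, ← mul_assoc (F.grp g), F.grp_mul_word]
  simp only [mul_assoc]

/-- The span of the products `w g` with `w` a word of length at most `z` and `g` in `G`. -/
def filt (z : ℤ) : Submodule ℂ H :=
  Submodule.span ℂ {h | ∃ (w : List V) (g : G), (w.length : ℤ) ≤ z ∧ h = F.word w * F.grp g}

/-- The span of the words of length at most `z`. -/
def pure (z : ℤ) : Submodule ℂ H :=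
  Submodule.span ℂ {h | ∃ w : List V, (w.length : ℤ) ≤ z ∧ h = F.word w}

theorem word_mul_grp_mem (w : List V) (g : G) {z : ℤ} (h : (w.length : ℤ) ≤ z) :
    F.word w * F.grp g ∈ F.filt z := Submodule.subset_span ⟨w, g, h, rfl⟩

theorem word_mem_pure (w : List V) {z : ℤ} (h : (w.length : ℤ) ≤ z) : F.word w ∈ F.pure z :=
  Submodule.subset_span ⟨w, h, rfl⟩

theorem grp_mem_filt (g : G) : F.grp g ∈ F.filt 0 := by
  simpa using F.word_mul_grp_mem [] g (z := 0) le_rfl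

theorem vec_mem_pure (x : V) : F.vec x ∈ F.pure 1 := by
  simpa [word] using F.word_mem_pure [x] (z := 1) le_rfl

theorem filt_mono {y z : ℤ} (h : y ≤ z) : F.filt y ≤ F.filt z :=
  Submodule.span_mono fun _ ⟨w, g, hw, e⟩ => ⟨w, g, hw.trans h, e⟩

theorem pure_le_filt (z : ℤ) : F.pure z ≤ F.filt z :=
  Submodule.span_mono fun _ ⟨w, hw, e⟩ => ⟨w, 1, hw, by rw [e, map_one, mul_one]⟩

theorem pure_of_neg {z : ℤ} (hz : z < 0) : F.pure z = ⊥ := by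
  rw [pure, Submodule.span_eq_bot]
  rintro _ ⟨w, hw, -⟩
  omega

theorem mul_mem_filt {m n : ℤ} {h h' : H} (hh : h ∈ F.filt m) (hh' : h' ∈ F.filt n) :
    h * h' ∈ F.filt (m + n) := by
  have := Submodule.mul_mem_mul hh hh'
  rw [filt, filt, Submodule.span_mul_span] at this
  refine Submodule.span_mono ?_ this
  rintro _ ⟨_, ⟨w, g, hw, rfl⟩, _, ⟨w', g', hw', rfl⟩, rfl⟩
  refine ⟨_, _, ?_, F.word_mul_word w w' g g'⟩
  simp only [List.length_append, List.length_map]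
  push_cast
  omega

theorem mul_mem_pure {m n : ℤ} {h h' : H} (hh : h ∈ F.pure m) (hh' : h' ∈ F.pure n) :
    h * h' ∈ F.pure (m + n) := by
  have := Submodule.mul_mem_mul hh hh'
  rw [pure, pure, Submodule.span_mul_span] at this
  refine Submodule.span_mono ?_ this
  rintro _ ⟨_, ⟨w, hw, rfl⟩, _, ⟨w', hw', rfl⟩, rfl⟩
  refine ⟨w ++ w', ?_, (F.word_append w w').symm⟩
  simp only [List.length_append]
  push_cast
  omega

theorem exists_mem_filt (h : H) : ∃ n : ℕ, h ∈ F.filt n := by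
  have hh : h ∈ (⊤ : Submodule ℂ H) := Submodule.mem_top
  rw [← F.span] at hh
  induction hh using Submodule.span_induction with
  | mem h hh =>
    obtain ⟨w, g, rfl⟩ := hh
    exact ⟨w.length, F.word_mul_grp_mem w g le_rfl⟩
  | zero => exact ⟨0, Submodule.zero_mem _⟩
  | add h h' _ _ ih ih' =>
    obtain ⟨n, hn⟩ := ih
    obtain ⟨n', hn'⟩ := ih'
    exact ⟨n + n', Submodule.add_mem _ (F.filt_mono (by push_cast; omega) hn)
      (F.filt_mono (by push_cast; omega) hn')⟩
  | smul a h _ ih =>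
    obtain ⟨n, hn⟩ := ih
    exact ⟨n, Submodule.smul_mem _ a hn⟩

theorem eqOn_filt {M : Type*} [AddCommGroup M] [Module ℂ M] {z : ℤ} (f f' : H →ₗ[ℂ] M)
    (hf : ∀ (w : List V) (g : G), (w.length : ℤ) ≤ z →
      f (F.word w * F.grp g) = f' (F.word w * F.grp g)) {h : H} (hh : h ∈ F.filt z) :
    f h = f' h :=
  LinearMap.eqOn_span' (by rintro _ ⟨w, g, hw, rfl⟩; exact hf w g hw) hh

theorem eqOn_pure {M : Type*} [AddCommGroup M] [Module ℂ M] {z : ℤ} (f f' : H →ₗ[ℂ] M)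
    (hf : ∀ w : List V, (w.length : ℤ) ≤ z → f (F.word w) = f' (F.word w)) {h : H}
    (hh : h ∈ F.pure z) : f h = f' h :=
  LinearMap.eqOn_span' (by rintro _ ⟨w, hw, rfl⟩; exact hf w hw) hh

end Words

/-! ### Symbols in the associated graded algebra `S(V) ⋊ G`. -/

section Symbol

/-- The symbol of degree `z` at the group element `k`. -/
def symbol (z : ℤ) (k : G) : H →ₗ[ℂ] MvPolynomial σ ℂ :=
  -- The leading term of `normal` only sees the coefficient of the identity; multiplication by `k⁻¹`
  -- brings the coefficient of `k` there.
  hcomp z ∘ₗ F.normal ∘ₗ LinearMap.mulRight ℂ (F.grp k⁻¹)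

theorem symbol_apply (z : ℤ) (k : G) (h : H) :
    F.symbol z k h = hcomp z (F.normal (h * F.grp k⁻¹)) := rfl

theorem symbol_mul_grp (z : ℤ) (k g : G) (h : H) :
    F.symbol z k (h * F.grp g) = F.symbol z (k * g⁻¹) h := by
  rw [symbol_apply, symbol_apply, mul_assoc, ← map_mul, mul_inv_rev, inv_inv]

theorem symbol_word_of_lt (w : List V) (g k : G) {z : ℤ} (h : (w.length : ℤ) < z) :
    F.symbol z k (F.word w * F.grp g) = 0 := by
  obtain ⟨n, rfl⟩ := Int.eq_ofNat_of_zero_le (a := z) (by omega)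
  rw [symbol_apply, mul_assoc, ← map_mul, hcomp_natCast, word, F.component_normal _ _ _ (by omega),
    if_neg fun h' => by omega]

theorem symbol_word_of_ne (w : List V) {g k : G} (hk : k ≠ g) {z : ℤ} (h : (w.length : ℤ) ≤ z) :
    F.symbol z k (F.word w * F.grp g) = 0 := by
  obtain ⟨n, rfl⟩ := Int.eq_ofNat_of_zero_le (a := z) (by omega)
  rw [symbol_apply, mul_assoc, ← map_mul, hcomp_natCast, word, F.component_normal _ _ _ (by omega),
    if_neg fun h' => hk (mul_inv_eq_one.1 h'.2).symm]

theorem symbol_word_self (w : List V) (g : G) :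
    F.symbol w.length g (F.word w * F.grp g) = symProd b w := by
  rw [symbol_apply, mul_assoc, ← map_mul, hcomp_natCast, word, F.component_normal _ _ _ le_rfl,
    if_pos ⟨rfl, mul_inv_cancel g⟩]

theorem symbol_eq_zero_of_lt {y z : ℤ} (hyz : y < z) (k : G) {h : H} (hh : h ∈ F.filt y) :
    F.symbol z k h = 0 :=
  F.eqOn_filt (F.symbol z k) 0 (fun w g hw => F.symbol_word_of_lt w g k (by omega)) hh

theorem symbol_eq_zero_of_ne {z : ℤ} {k : G} (hk : k ≠ 1) {h : H} (hh : h ∈ F.pure z) :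
    F.symbol z k h = 0 :=
  F.eqOn_pure (F.symbol z k) 0 (fun w hw => by
    simpa using F.symbol_word_of_ne w hk hw) hh

theorem symbol_vec (x : V) : F.symbol 1 1 (F.vec x) = lin b x := by
  simpa [word, symProd] using F.symbol_word_self [x] 1

variable [MulSemiringAction G (MvPolynomial σ ℂ)] [SMulCommClass G ℂ (MvPolynomial σ ℂ)]

theorem symProd_append (w w' : List V) : symProd b (w ++ w') = symProd b w * symProd b w' := by
  simp [symProd]

theorem symProd_map_smul (hlin : ∀ (g : G) x, lin b (g • x) = g • lin b x) (g : G) (w : List V) :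
    symProd b (w.map (g • ·)) = g • symProd b w := by
  induction w with
  | nil => simp [symProd]
  | cons x w ih =>
    simp only [symProd, List.map_cons, List.prod_cons, smul_mul', hlin] at ih ⊢
    rw [ih]

/-- This is multiplication in `S(V) ⋊ G`. By linearity it is enough to multiply two products of a
word and a group element. -/
theorem symbol_mul (hlin : ∀ (g : G) x, lin b (g • x) = g • lin b x) {m n : ℤ} {h h' : H}
    (hh : h ∈ F.filt m) (hh' : h' ∈ F.filt n) (k : G) :
    F.symbol (m + n) k (h * h') =
      ∑ g, F.symbol m g h * g • F.symbol n (g⁻¹ * k) h' := by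
  let R : G → MvPolynomial σ ℂ →ₗ[ℂ] MvPolynomial σ ℂ :=
    fun g => DistribSMul.toLinearMap ℂ (MvPolynomial σ ℂ) g
  refine F.eqOn_filt (F.symbol (m + n) k ∘ₗ LinearMap.mulRight ℂ h')
    (∑ g, LinearMap.mulRight ℂ (g • F.symbol n (g⁻¹ * k) h') ∘ₗ F.symbol m g) ?_ hh |>.trans
    (by simp)
  intro w g hw
  refine F.eqOn_filt (F.symbol (m + n) k ∘ₗ LinearMap.mulLeft ℂ (F.word w * F.grp g))
    (∑ g', LinearMap.mulLeft ℂ (F.symbol m g' (F.word w * F.grp g)) ∘ₗ R g' ∘ₗ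
      F.symbol n (g'⁻¹ * k)) ?_ hh' |>.trans (by simp [R])
  intro w' g' hw'
  simp only [LinearMap.comp_apply, LinearMap.mulLeft_apply, LinearMap.sum_apply]
  rw [Finset.sum_eq_single g (fun g'' _ hg'' => by
    rw [F.symbol_word_of_ne w hg'' hw, zero_mul]) (by simp), F.word_mul_word]
  change _ = _ * g • F.symbol n (g⁻¹ * k) (F.word w' * F.grp g')
  have hlen : ((w ++ w'.map (g • · : V → V)).length : ℤ) = w.length + w'.length := by simp
  by_cases hk : g⁻¹ * k = g'
  · obtain rfl : k = g * g' := by rw [← hk, mul_inv_cancel_left]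
    rw [hk]
    rcases hw.lt_or_eq with hw | rfl
    · rw [F.symbol_word_of_lt w g g hw, zero_mul, F.symbol_word_of_lt _ _ _ (by omega)]
    rcases hw'.lt_or_eq with hw' | rfl
    · rw [F.symbol_word_of_lt w' g' g' hw', smul_zero, mul_zero,
        F.symbol_word_of_lt _ _ _ (by omega)]
    rw [← hlen, F.symbol_word_self, F.symbol_word_self, F.symbol_word_self, symProd_append,
      symProd_map_smul hlin]
  · rw [F.symbol_word_of_ne w' hk hw', smul_zero, mul_zero,
      F.symbol_word_of_ne _ (fun h => hk (by rw [h, inv_mul_cancel_left])) (by omega)]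

theorem symbol_mul_pure (hlin : ∀ (g : G) x, lin b (g • x) = g • lin b x) {m n : ℤ} {h a : H}
    (hh : h ∈ F.filt m) (ha : a ∈ F.pure n) (k : G) :
    F.symbol (m + n) k (h * a) = F.symbol m k h * k • F.symbol n 1 a := by
  rw [F.symbol_mul hlin hh (F.pure_le_filt n ha), Finset.sum_eq_single k (fun g _ hg => by
    rw [F.symbol_eq_zero_of_ne (fun h => hg (inv_mul_eq_one.1 h)) ha, smul_zero, mul_zero])
    (by simp), inv_mul_cancel]

theorem symbol_pure_mul (hlin : ∀ (g : G) x, lin b (g • x) = g • lin b x) {m n : ℤ} {a h : H}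
    (ha : a ∈ F.pure m) (hh : h ∈ F.filt n) (k : G) :
    F.symbol (m + n) k (a * h) = F.symbol m 1 a * F.symbol n k h := by
  rw [F.symbol_mul hlin (F.pure_le_filt m ha) hh, Finset.sum_eq_single 1 (fun g _ hg => by
    rw [F.symbol_eq_zero_of_ne hg ha, zero_mul]) (by simp), one_smul, inv_one, one_mul]

theorem symbol_grp_mul (hlin : ∀ (g : G) x, lin b (g • x) = g • lin b x) {n : ℤ} {h : H}
    (hh : h ∈ F.filt n) (g k : G) :
    F.symbol n k (F.grp g * h) = g • F.symbol n (g⁻¹ * k) h := by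
  have := F.symbol_mul hlin (F.grp_mem_filt g) hh k
  rw [zero_add] at this
  rw [this, Finset.sum_eq_single g (fun g' _ hg' => by
    have := F.symbol_word_of_ne [] hg' (z := 0) le_rfl
    rw [word_nil, one_mul] at this
    rw [this, zero_mul]) (by simp)]
  have := F.symbol_word_self [] g
  rw [word_nil, one_mul] at this
  change _ * _ = _
  have h1 : F.symbol 0 g (F.grp g) = 1 := this
  rw [h1, one_mul]

end Symbol

/-! ### Lifting polynomials to elements with prescribed symbol. -/

section Lift

/-- A linear section of the symbol map, given by arbitrarily ordered monomials. -/
def ofPoly : MvPolynomial σ ℂ →ₗ[ℂ] H :=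
  (basisMonomials σ ℂ).constr ℂ fun α => F.word ((Finsupp.toMultiset α).toList.map b)

theorem ofPoly_monomial (α : σ →₀ ℕ) :
    F.ofPoly (monomial α 1) = F.word ((Finsupp.toMultiset α).toList.map b) := by
  have := (basisMonomials σ ℂ).constr_basis ℂ
    (fun α => F.word ((Finsupp.toMultiset α).toList.map b)) α
  rwa [coe_basisMonomials] at this

theorem symProd_toList (α : σ →₀ ℕ) :
    symProd b ((Finsupp.toMultiset α).toList.map b) = monomial α 1 := by
  have : symProd b ((Finsupp.toMultiset α).toList.map b) =
      (((Finsupp.toMultiset α).map (X : σ → MvPolynomial σ ℂ))).prod := by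
    rw [symProd, List.map_map, ← Multiset.prod_coe, ← Multiset.map_coe, Multiset.coe_toList]
    congr 2
    funext i
    exact lin_basis b i
  rw [this, Finsupp.toMultiset_map, Finsupp.prod_toMultiset, monomial_eq]
  simp [Finsupp.prod_mapDomain_index, pow_add]

theorem length_toList (α : σ →₀ ℕ) :
    ((Finsupp.toMultiset α).toList.map b).length = α.degree := by
  rw [List.length_map, Multiset.length_toList, Finsupp.card_toMultiset]
  rfl

theorem isHomogeneous_induction {n : ℕ} {C : MvPolynomial σ ℂ → Prop}
    (monomial : ∀ α : σ →₀ ℕ, α.degree = n → C (monomial α 1)) (zero : C 0)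
    (add : ∀ f f', C f → C f' → C (f + f')) (smul : ∀ (z : ℂ) f, C f → C (z • f))
    {f : MvPolynomial σ ℂ} (hf : f.IsHomogeneous n) : C f := by
  rw [f.as_sum]
  refine Finset.sum_induction _ C add zero fun α hα => ?_
  have : MvPolynomial.monomial α (f.coeff α) = f.coeff α • MvPolynomial.monomial α 1 := by
    rw [smul_monomial, smul_eq_mul, mul_one]
  rw [this]
  refine smul _ _ (monomial α ?_)
  have := hf (mem_support_iff.1 hα)
  rwa [Finsupp.degree_eq_weight_one]

theorem ofPoly_mem_pure {n : ℕ} {f : MvPolynomial σ ℂ} (hf : f.IsHomogeneous n) :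
    F.ofPoly f ∈ F.pure n := by
  refine isHomogeneous_induction (C := fun f => F.ofPoly f ∈ F.pure n)
    (fun α hα => ?_) ?_ (fun f f' h h' => ?_) (fun z f h => ?_) hf
  · rw [ofPoly_monomial]
    exact F.word_mem_pure _ (by rw [length_toList, hα])
  · rw [map_zero]; exact Submodule.zero_mem _
  · rw [map_add]; exact Submodule.add_mem _ h h'
  · rw [map_smul]; exact Submodule.smul_mem _ z h

theorem symbol_ofPoly {n : ℕ} {f : MvPolynomial σ ℂ} (hf : f.IsHomogeneous n) :
    F.symbol n 1 (F.ofPoly f) = f := by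
  refine isHomogeneous_induction (C := fun f => F.symbol n 1 (F.ofPoly f) = f)
    (fun α hα => ?_) ?_ (fun f f' h h' => ?_) (fun z f h => ?_) hf
  · have := F.symbol_word_self ((Finsupp.toMultiset α).toList.map b) 1
    rwa [map_one, mul_one, length_toList, hα, symProd_toList, ← ofPoly_monomial] at this
  · simp
  · rw [map_add, map_add, h, h']
  · rw [map_smul, map_smul, h]

theorem comm_mem_filt (x y : V) : F.vec x * F.vec y - F.vec y * F.vec x ∈ F.filt 0 := by
  rw [F.comm]
  exact Submodule.sum_mem _ fun k _ => Submodule.smul_mem _ _ (F.grp_mem_filt k)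

/-- An adjacent transposition replaces two letters by a combination of group elements, so it only
affects lower order. -/
theorem word_sub_word_mem {w w' : List V} (h : w.Perm w') :
    F.word w - F.word w' ∈ F.filt (w.length - 1) := by
  induction h with
  | nil => rw [sub_self]; exact Submodule.zero_mem _
  | cons x _ ih =>
    rw [word_cons, word_cons, ← mul_sub]
    have := F.mul_mem_filt (F.pure_le_filt _ (F.vec_mem_pure x)) ih
    refine F.filt_mono ?_ this
    simp only [List.length_cons]
    push_cast
    omega
  | swap x y w =>
    rw [word_cons, word_cons, word_cons, word_cons, ← mul_assoc, ← mul_assoc, ← sub_mul]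
    have := F.mul_mem_filt (F.comm_mem_filt y x) (F.pure_le_filt _ (F.word_mem_pure w le_rfl))
    refine F.filt_mono ?_ this
    simp only [List.length_cons]
    push_cast
    omega
  | trans h _ ih ih' =>
    rw [← h.length_eq] at ih'
    simpa using Submodule.add_mem _ ih ih'

theorem exists_toList_perm [DecidableEq σ] (l : List σ) :
    l.Perm (Finsupp.toMultiset (Multiset.toFinsupp (l : Multiset σ))).toList := by
  rw [← Multiset.coe_eq_coe, Multiset.coe_toList, Multiset.toFinsupp_toMultiset]

theorem word_basis_sub_mem (l : List σ) :
    F.word (l.map b) - F.ofPoly (symProd b (l.map b)) ∈ F.filt (l.length - 1) := by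
  classical
  set α := Multiset.toFinsupp (l : Multiset σ)
  have hp := (exists_toList_perm l).map b
  have h1 : symProd b (l.map b) = monomial α 1 := by
    rw [← symProd_toList (b := b)]
    exact (hp.map _).prod_eq
  rw [h1, ofPoly_monomial]
  simpa only [List.length_map] using F.word_sub_word_mem hp

theorem word_sub_ofPoly_mem (w : List V) :
    F.word w - F.ofPoly (symProd b w) ∈ F.filt (w.length - 1) := by
  -- The list `l` holds the letters already expanded in the basis; linearity expands the next letter
  -- of `w`.
  suffices h : ∀ (w : List V) (l : List σ), F.word (l.map b ++ w) -
      F.ofPoly (symProd b (l.map b ++ w)) ∈ F.filt (l.length + w.length - 1) by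
    simpa using h w []
  intro w
  induction w with
  | nil => intro l; simpa using F.word_basis_sub_mem l
  | cons x w ih =>
    intro l
    have hx : x ∈ Submodule.span ℂ (Set.range b) := b.mem_span x
    induction hx using Submodule.span_induction with
    | mem x hx =>
      obtain ⟨i, rfl⟩ := hx
      have := ih (l ++ [i])
      simp only [List.map_append, List.map_cons, List.map_nil, List.append_assoc,
        List.singleton_append, List.length_append, List.length_singleton] at this
      refine F.filt_mono ?_ this
      simp only [List.length_cons]
      push_cast
      omega
    | zero =>
      simp [word, symProd]
    | add x y _ _ hx hy =>
      have h1 : F.word (l.map b ++ (x + y) :: w) =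
          F.word (l.map b ++ x :: w) + F.word (l.map b ++ y :: w) := by
        simp [word, mul_add, add_mul]
      have h2 : symProd b (l.map b ++ (x + y) :: w) =
          symProd b (l.map b ++ x :: w) + symProd b (l.map b ++ y :: w) := by
        simp [symProd, mul_add, add_mul]
      rw [h1, h2, map_add, add_sub_add_comm]
      exact Submodule.add_mem _ hx hy
    | smul z x _ hx =>
      have h1 : F.word (l.map b ++ (z • x) :: w) = z • F.word (l.map b ++ x :: w) := by
        simp [word]
      have h2 : symProd b (l.map b ++ (z • x) :: w) = z • symProd b (l.map b ++ x :: w) := by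
        simp [symProd]
      rw [h1, h2, map_smul, ← smul_sub]
      exact Submodule.smul_mem _ z hx

/-- The symbol at `1` determines an element of `pure z` modulo lower order. The remainder is only in
`filt`, because reordering letters creates group elements. -/
theorem sub_ofPoly_symbol_mem {z : ℤ} {a : H} (ha : a ∈ F.pure z) :
    a - F.ofPoly (F.symbol z 1 a) ∈ F.filt (z - 1) := by
  induction ha using Submodule.span_induction with
  | mem a ha =>
    obtain ⟨w, hw, rfl⟩ := ha
    have hs := F.symbol_word_of_lt w 1 1 (z := z)
    have hs' := F.symbol_word_self w 1
    rw [map_one, mul_one] at hs hs'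
    rcases hw.lt_or_eq with hw | rfl
    · rw [hs hw, map_zero, sub_zero]
      exact F.pure_le_filt _ (F.word_mem_pure w (by omega))
    · rw [hs']
      exact F.word_sub_ofPoly_mem w
  | zero => simp
  | add a a' _ _ h h' =>
    rw [map_add, map_add, add_sub_add_comm]
    exact Submodule.add_mem _ h h'
  | smul c a _ h =>
    rw [map_smul, map_smul, ← smul_sub]
    exact Submodule.smul_mem _ c h

end Lift

end FlatAlgebra

/-! ### The Poisson bracket on polynomials. -/

section Poisson

variable {V : Type*} [AddCommGroup V] [Module ℂ V] {σ : Type*} [Fintype σ]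
  (b : Module.Basis σ ℂ V) (η : LinearMap.BilinForm ℂ V)

/-- The Poisson bracket on `S(V)` induced by a bilinear form on `V`. -/
def poisson (f : MvPolynomial σ ℂ) : Derivation ℂ (MvPolynomial σ ℂ) (MvPolynomial σ ℂ) :=
  ∑ j, (∑ i, C (η (b i) (b j)) * pderiv i f) • pderiv j

theorem poisson_apply (f h : MvPolynomial σ ℂ) :
    poisson b η f h = ∑ j, (∑ i, C (η (b i) (b j)) * pderiv i f) * pderiv j h := by
  rw [poisson, derivation_sum_apply]
  rfl

theorem poisson_swap {η : LinearMap.BilinForm ℂ V} (hη : η.IsAlt) (f h : MvPolynomial σ ℂ) :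
    poisson b η f h = -poisson b η h f := by
  simp only [poisson_apply, Finset.sum_mul]
  rw [Finset.sum_comm, ← Finset.sum_neg_distrib]
  refine Finset.sum_congr rfl fun i _ => ?_
  rw [← Finset.sum_neg_distrib]
  refine Finset.sum_congr rfl fun j _ => ?_
  rw [← hη.neg_eq (b j) (b i), map_neg]
  ring

theorem poisson_basis_lin (i : σ) (y : V) : poisson b η (X i) (lin b y) = C (η (b i) y) := by
  have : (poisson b η (X i)).toLinearMap ∘ₗ lin b =
      (Algebra.linearMap ℂ (MvPolynomial σ ℂ)) ∘ₗ η (b i) := by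
    refine b.ext fun j => ?_
    classical
    simp only [LinearMap.comp_apply, lin_basis]
    change poisson b η (X i) (X j) = C (η (b i) (b j))
    rw [poisson_apply, Finset.sum_eq_single j (fun j' _ hj' => by
      rw [pderiv_X_of_ne hj'.symm, mul_zero]) (by simp), Finset.sum_eq_single i (fun i' _ hi' => by
      rw [pderiv_X_of_ne hi'.symm, mul_zero]) (by simp), pderiv_X_self, pderiv_X_self, mul_one,
      mul_one]
  exact LinearMap.congr_fun this y

theorem poisson_lin {η : LinearMap.BilinForm ℂ V} (hη : η.IsAlt) (x y : V) :
    poisson b η (lin b x) (lin b y) = C (η x y) := by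
  have : (poisson b η (lin b y)).toLinearMap ∘ₗ lin b =
      (Algebra.linearMap ℂ (MvPolynomial σ ℂ)) ∘ₗ η y := by
    refine b.ext fun j => ?_
    simp only [LinearMap.comp_apply, lin_basis]
    change poisson b η (lin b y) (X j) = C (η y (b j))
    rw [poisson_swap b hη, poisson_basis_lin, ← map_neg, hη.neg_eq]
  rw [poisson_swap b hη, ← hη.neg_eq y x, map_neg]
  exact congrArg Neg.neg (LinearMap.congr_fun this x)

end Poisson

namespace FlatAlgebra

variable {G V : Type*} [Group G] [Fintype G] [AddCommGroup V] [Module ℂ V]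
  [DistribMulAction G V] [SMulCommClass G ℂ V] {σ : Type*} [Fintype σ] {b : Module.Basis σ ℂ V}
  {κ : G → LinearMap.BilinForm ℂ V} {H : Type*} [Ring H] [Algebra ℂ H] (F : FlatAlgebra b κ H)
  [MulSemiringAction G (MvPolynomial σ ℂ)] [SMulCommClass G ℂ (MvPolynomial σ ℂ)]

/-! ### Commutators in `H` and their symbols. -/

section Commutator

/-- The commutator of `a` and `c` has order at most `m + n - 2` and its symbol at `1` is the
Poisson bracket of the symbols of `a` and `c`. -/
def HasBracket (m n : ℤ) (a c : H) : Prop :=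
  a * c - c * a ∈ F.filt (m + n - 2) ∧ F.symbol (m + n - 2) 1 (a * c - c * a) =
    poisson b (κ 1) (F.symbol m 1 a) (F.symbol n 1 c)

variable {F} {m m' n : ℤ} {a a' c : H}

theorem HasBracket.swap (hκ : (κ 1).IsAlt) (h : F.HasBracket m n a c) : F.HasBracket n m c a := by
  have e : c * a - a * c = -(a * c - c * a) := by abel
  rw [HasBracket, add_comm n m, e, map_neg, poisson_swap b hκ, h.2]
  exact ⟨Submodule.neg_mem _ h.1, rfl⟩

theorem HasBracket.mul_left (hlin : ∀ (g : G) x, lin b (g • x) = g • lin b x)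
    (hκ : (κ 1).IsAlt) (ha : a ∈ F.pure m) (ha' : a' ∈ F.pure m')
    (h : F.HasBracket m n a c) (h' : F.HasBracket m' n a' c) :
    F.HasBracket (m + m') n (a * a') c := by
  have e : a * a' * c - c * (a * a') = a * (a' * c - c * a') + (a * c - c * a) * a' := by
    simp only [mul_sub, sub_mul, mul_assoc]; abel
  have e1 : m + m' + n - 2 = m + (m' + n - 2) := by ring
  have e2 : m + m' + n - 2 = (m + n - 2) + m' := by ring
  refine ⟨?_, ?_⟩
  · rw [e]
    exact Submodule.add_mem _ (e1 ▸ F.mul_mem_filt (F.pure_le_filt _ ha) h'.1)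
      (e2 ▸ F.mul_mem_filt h.1 (F.pure_le_filt _ ha'))
  · have s1 := F.symbol_pure_mul hlin ha h'.1 1
    have s2 := F.symbol_mul_pure hlin h.1 ha' 1
    have s3 := F.symbol_pure_mul hlin ha (F.pure_le_filt _ ha') 1
    rw [← e1] at s1
    rw [← e2, one_smul] at s2
    rw [e, map_add, s1, s2, s3, h.2, h'.2, poisson_swap b hκ (_ * _), Derivation.leibniz,
      poisson_swap b hκ (F.symbol m 1 a), poisson_swap b hκ (F.symbol m' 1 a'), smul_eq_mul,
      smul_eq_mul]
    ring

theorem HasBracket.of_lt (h : F.HasBracket m' n a c) (ha : a ∈ F.pure m') (hm : m' < m) :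
    F.HasBracket m n a c := by
  refine ⟨F.filt_mono (by omega) h.1, ?_⟩
  rw [F.symbol_eq_zero_of_lt (by omega) _ h.1, F.symbol_eq_zero_of_lt hm _ (F.pure_le_filt _ ha),
    poisson_apply]
  simp

theorem HasBracket.add (hκ : (κ 1).IsAlt) (h : F.HasBracket m n a c)
    (h' : F.HasBracket m n a' c) : F.HasBracket m n (a + a') c := by
  have e : (a + a') * c - c * (a + a') = (a * c - c * a) + (a' * c - c * a') := by
    simp only [mul_add, add_mul]; abel
  rw [HasBracket, e, map_add, map_add, h.2, h'.2, poisson_swap b hκ (_ + _), map_add,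
    poisson_swap b hκ (F.symbol m 1 a), poisson_swap b hκ (F.symbol m 1 a')]
  exact ⟨Submodule.add_mem _ h.1 h'.1, by ring⟩

theorem HasBracket.smul (hκ : (κ 1).IsAlt) (z : ℂ) (h : F.HasBracket m n a c) :
    F.HasBracket m n (z • a) c := by
  have e : (z • a) * c - c * (z • a) = z • (a * c - c * a) := by
    rw [smul_mul_assoc, mul_smul_comm, smul_sub]
  rw [HasBracket, e, map_smul, map_smul, h.2, poisson_swap b hκ (_ • _), Derivation.map_smul,
    poisson_swap b hκ (F.symbol m 1 a), smul_neg]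
  exact ⟨Submodule.smul_mem _ z h.1, rfl⟩

theorem HasBracket.zero (hκ : (κ 1).IsAlt) : F.HasBracket m n 0 c := by
  rw [HasBracket, poisson_swap b hκ]
  simp

variable (F)

theorem hasBracket_one (c : H) : F.HasBracket 0 n 1 c := by
  have := F.symbol_word_self [] 1
  simp only [word_nil, map_one, mul_one, List.length_nil, Nat.cast_zero] at this
  rw [HasBracket, this, poisson_apply]
  simp [symProd]

theorem hasBracket_vec (hκ : (κ 1).IsAlt) (x y : V) : F.HasBracket 1 1 (F.vec x) (F.vec y) := by
  have e : (1 : ℤ) + 1 - 2 = 0 := by norm_num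
  rw [HasBracket, e, symbol_vec, symbol_vec, poisson_lin b hκ]
  refine ⟨F.comm_mem_filt x y, ?_⟩
  have h1 : ∀ k : G, k ≠ 1 → F.symbol 0 1 (F.grp k) = 0 := fun k hk => by
    simpa using F.symbol_word_of_ne [] hk.symm (z := 0) le_rfl
  have h2 : F.symbol 0 1 (F.grp 1) = 1 := by
    simpa [symProd] using F.symbol_word_self [] 1
  rw [F.comm, map_sum, Finset.sum_eq_single 1 (fun k _ hk => by rw [map_smul, h1 k hk, smul_zero])
    (by simp), map_smul, h2, C_eq_smul_one]

theorem hasBracket_word (hlin : ∀ (g : G) x, lin b (g • x) = g • lin b x) (hκ : (κ 1).IsAlt)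
    {c : H} (hc : ∀ x, F.HasBracket 1 n (F.vec x) c) (w : List V) :
    F.HasBracket w.length n (F.word w) c := by
  induction w with
  | nil => exact F.hasBracket_one c
  | cons x w ih =>
    rw [word_cons]
    have := HasBracket.mul_left hlin hκ (F.vec_mem_pure x) (F.word_mem_pure w le_rfl) (hc x) ih
    rwa [List.length_cons, Nat.cast_succ, add_comm]

theorem hasBracket_of_mem_pure (hlin : ∀ (g : G) x, lin b (g • x) = g • lin b x)
    (hκ : (κ 1).IsAlt) {c : H} (hc : ∀ x, F.HasBracket 1 n (F.vec x) c) (ha : a ∈ F.pure m) :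
    F.HasBracket m n a c := by
  induction ha using Submodule.span_induction with
  | mem a ha =>
    obtain ⟨w, hw, rfl⟩ := ha
    have := F.hasBracket_word hlin hκ hc w
    rcases hw.lt_or_eq with hw | rfl
    · exact this.of_lt (F.word_mem_pure w le_rfl) hw
    · exact this
  | zero => exact .zero hκ
  | add a a' _ _ h h' => exact h.add hκ h'
  | smul z a _ h => exact h.smul hκ z

/-- Both the commutator and the Poisson bracket obey the Leibniz rule in each variable, so the case
of two vectors suffices. Extending to words is done one variable at a time, using antisymmetry. -/
theorem hasBracket (hlin : ∀ (g : G) x, lin b (g • x) = g • lin b x)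
    (hκ : (κ 1).IsAlt) (ha : a ∈ F.pure m) (hc : c ∈ F.pure n) : F.HasBracket m n a c :=
  F.hasBracket_of_mem_pure hlin hκ (fun x =>
    (F.hasBracket_of_mem_pure hlin hκ (fun y => F.hasBracket_vec hκ y x) hc).swap hκ) ha

theorem commutator_mem_filt (hlin : ∀ (g : G) x, lin b (g • x) = g • lin b x)
    (hκ : (κ 1).IsAlt) {h : H} (hh : h ∈ F.filt m) (hc : c ∈ F.pure n)
    (hcomm : ∀ g, F.grp g * c = c * F.grp g) : h * c - c * h ∈ F.filt (m + n - 2) := by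
  induction hh using Submodule.span_induction with
  | mem h hh =>
    obtain ⟨w, g, hw, rfl⟩ := hh
    have e : F.word w * F.grp g * c - c * (F.word w * F.grp g) =
        (F.word w * c - c * F.word w) * F.grp g := by
      rw [mul_assoc, hcomm, sub_mul, mul_assoc, mul_assoc]
    rw [e]
    have := F.mul_mem_filt (F.hasBracket hlin hκ (F.word_mem_pure w hw) hc).1 (F.grp_mem_filt g)
    rwa [add_zero] at this
  | zero => simp
  | add h h' _ _ ih ih' =>
    have e : (h + h') * c - c * (h + h') = (h * c - c * h) + (h' * c - c * h') := by
      simp only [mul_add, add_mul]; abel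
    rw [e]
    exact Submodule.add_mem _ ih ih'
  | smul z h _ ih =>
    rw [smul_mul_assoc, mul_smul_comm, ← smul_sub]
    exact Submodule.smul_mem _ z ih

theorem lin_injective : Function.Injective (lin b) := by
  have : LinearIndependent ℂ (X : σ → MvPolynomial σ ℂ) := by
    have h := (basisMonomials σ ℂ).linearIndependent.comp (fun i : σ => Finsupp.single i 1)
      (Finsupp.single_left_injective one_ne_zero)
    rw [coe_basisMonomials] at h
    exact h
  intro x y hxy
  simp only [lin, Module.Basis.constr_apply] at hxy
  exact b.repr.injective (this hxy)

/-- Expand `[[a, x], c]` for a vector `x` moved by `g`. It has order `m + n - 3`, so its symbol in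
degree `m + n - 1` is zero. The terms containing `[x, c]` cancel there because the symbol of `a` is
fixed by `g`, which leaves the symbol of `[a, c]` times the nonzero `g • x - x`. -/
theorem symbol_commutator_eq_zero (hlin : ∀ (g : G) x, lin b (g • x) = g • lin b x)
    (hκ : (κ 1).IsAlt) {g : G} (hg : ∃ x : V, g • x ≠ x) (ha : a ∈ F.pure m)
    (hc : c ∈ F.pure n) (hcomm : ∀ g, F.grp g * c = c * F.grp g)
    (hinv : g • F.symbol m 1 a = F.symbol m 1 a) :
    F.symbol (m + n - 2) g (a * c - c * a) = 0 := by
  obtain ⟨x, hx⟩ := hg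
  have hxp := F.vec_mem_pure x
  have h1 := (F.hasBracket hlin hκ ha hxp).1
  have h2 := F.commutator_mem_filt hlin hκ h1 hc hcomm
  have h3 := (F.hasBracket hlin hκ ha hc).1
  have h4 := (F.hasBracket hlin hκ hxp hc).1
  have e : (a * F.vec x - F.vec x * a) * c - c * (a * F.vec x - F.vec x * a) =
      a * (F.vec x * c - c * F.vec x) + (a * c - c * a) * F.vec x
        - F.vec x * (a * c - c * a) - (F.vec x * c - c * F.vec x) * a := by
    simp only [mul_sub, sub_mul, mul_assoc]; abel
  have h5 := F.symbol_eq_zero_of_lt (z := m + (1 + n - 2)) (by omega) g h2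
  have s1 := F.symbol_pure_mul hlin ha h4 g
  have s2 := F.symbol_mul_pure hlin h3 hxp g
  have s3 := F.symbol_pure_mul hlin hxp h3 g
  have s4 := F.symbol_mul_pure hlin h4 ha g
  rw [show m + n - 2 + 1 = m + (1 + n - 2) by ring] at s2
  rw [show 1 + (m + n - 2) = m + (1 + n - 2) by ring] at s3
  rw [show 1 + n - 2 + m = m + (1 + n - 2) by ring, hinv] at s4
  rw [e, map_sub, map_sub, map_add, s1, s2, s3, s4, symbol_vec, ← hlin] at h5
  have h6 : F.symbol (m + n - 2) g (a * c - c * a) * (lin b (g • x) - lin b x) = 0 := by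
    rw [← h5]; ring
  refine (mul_eq_zero.1 h6).resolve_right fun h => hx (lin_injective (sub_eq_zero.1 h))

end Commutator

/-! ### The filtration of the spherical subalgebra and its symbols. -/

section Spherical

/-- The symmetrizer. -/
def avg : H := (Fintype.card G : ℂ)⁻¹ • ∑ g, F.grp g

theorem card_ne_zero_complex : (Fintype.card G : ℂ) ≠ 0 := by exact_mod_cast Fintype.card_ne_zero

theorem avg_mul_grp (g : G) : F.avg * F.grp g = F.avg := by
  rw [avg, smul_mul_assoc, Finset.sum_mul]
  simp_rw [← map_mul]
  rw [Fintype.sum_equiv (Equiv.mulRight g) (fun x => F.grp (x * g)) F.grp fun _ => rfl]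

theorem grp_mul_avg (g : G) : F.grp g * F.avg = F.avg := by
  rw [avg, mul_smul_comm, Finset.mul_sum]
  simp_rw [← map_mul]
  rw [Fintype.sum_equiv (Equiv.mulLeft g) (fun x => F.grp (g * x)) F.grp fun _ => rfl]

theorem avg_mul_avg : F.avg * F.avg = F.avg := by
  nth_rw 1 [avg]
  rw [smul_mul_assoc, Finset.sum_mul, Finset.sum_congr rfl fun g _ => F.grp_mul_avg g,
    Finset.sum_const, Finset.card_univ, ← Nat.cast_smul_eq_nsmul ℂ, smul_smul,
    inv_mul_cancel₀ (card_ne_zero_complex (G := G)), one_smul]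

/-- The sum of the symbols of degree `z` at the elements of the group. -/
def total (z : ℤ) : H →ₗ[ℂ] MvPolynomial σ ℂ := ∑ k, F.symbol z k

theorem total_apply (z : ℤ) (h : H) : F.total z h = ∑ k, F.symbol z k h := by
  rw [total, LinearMap.sum_apply]

theorem total_mul_grp (z : ℤ) (h : H) (g : G) : F.total z (h * F.grp g) = F.total z h := by
  rw [total_apply, total_apply]
  simp_rw [symbol_mul_grp]
  exact Fintype.sum_equiv (Equiv.mulRight g⁻¹) _ _ fun _ => rfl

/-- Right multiplication by a group element only permutes the symbols, so their sum survives
multiplication by `e`. -/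
theorem total_mul_avg (z : ℤ) (h : H) : F.total z (h * F.avg) = F.total z h := by
  rw [avg, mul_smul_comm, Finset.mul_sum, map_smul, map_sum]
  simp_rw [total_mul_grp]
  rw [Finset.sum_const, Finset.card_univ, ← Nat.cast_smul_eq_nsmul ℂ, smul_smul,
    inv_mul_cancel₀ (card_ne_zero_complex (G := G)), one_smul]

theorem total_grp_mul (hlin : ∀ (g : G) x, lin b (g • x) = g • lin b x) {z : ℤ} {h : H}
    (hh : h ∈ F.filt z) (g : G) : F.total z (F.grp g * h) = g • F.total z h := by
  rw [total_apply, total_apply, Finset.smul_sum]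
  simp_rw [F.symbol_grp_mul hlin hh]
  exact Fintype.sum_equiv (Equiv.mulLeft g⁻¹) _ _ fun _ => rfl

theorem total_of_mem_pure {z : ℤ} {a : H} (ha : a ∈ F.pure z) : F.total z a = F.symbol z 1 a := by
  rw [total_apply]
  exact Finset.sum_eq_single 1 (fun k _ hk => F.symbol_eq_zero_of_ne hk ha) (by simp)

theorem total_eq_zero_of_lt {y z : ℤ} (hyz : y < z) {h : H} (hh : h ∈ F.filt y) :
    F.total z h = 0 := by
  rw [total_apply]
  exact Finset.sum_eq_zero fun k _ => F.symbol_eq_zero_of_lt hyz k hh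

/-- The elements of order at most `z` of the spherical subalgebra. -/
def sph (z : ℤ) : Submodule ℂ H :=
  (F.pure z ⊓ Subalgebra.toSubmodule (Subalgebra.centralizer ℂ (Set.range F.grp))).map
    (LinearMap.mulLeft ℂ F.avg)

theorem mem_sph {z : ℤ} {h : H} : h ∈ F.sph z ↔
    ∃ a ∈ F.pure z, (∀ g, F.grp g * a = a * F.grp g) ∧ F.avg * a = h := by
  simp only [sph, Submodule.mem_map, Submodule.mem_inf, Subalgebra.mem_toSubmodule,
    Subalgebra.mem_centralizer_iff, Set.forall_mem_range, LinearMap.mulLeft_apply, and_assoc]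

theorem avg_mul_comm {a : H} (ha : ∀ g, F.grp g * a = a * F.grp g) :
    F.avg * a = a * F.avg := by
  rw [avg, smul_mul_assoc, mul_smul_comm, Finset.sum_mul, Finset.mul_sum]
  simp_rw [ha]

/-- The average of the conjugates of an element of `H`. -/
def conjAvg : H →ₗ[ℂ] H := (Fintype.card G : ℂ)⁻¹ •
  ∑ g, LinearMap.mulLeft ℂ (F.grp g) ∘ₗ LinearMap.mulRight ℂ (F.grp g⁻¹)

theorem conjAvg_apply (h : H) :
    F.conjAvg h = (Fintype.card G : ℂ)⁻¹ • ∑ g, F.grp g * (h * F.grp g⁻¹) := by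
  simp [conjAvg, LinearMap.sum_apply]

theorem grp_mul_conjAvg (g : G) (h : H) : F.grp g * F.conjAvg h = F.conjAvg h * F.grp g := by
  rw [conjAvg_apply, mul_smul_comm, smul_mul_assoc, Finset.mul_sum, Finset.sum_mul]
  congr 1
  refine Fintype.sum_equiv (Equiv.mulLeft g) _ _ fun x => ?_
  simp only [Equiv.coe_mulLeft, map_mul, mul_inv_rev, mul_assoc]
  rw [← map_mul F.grp g⁻¹ g, inv_mul_cancel, map_one, mul_one]

/-- Every `e h e` thereby takes the form `e a` with `a` commuting with `G`, which is the form used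
in `sph`. -/
theorem avg_mul_conjAvg (h : H) : F.avg * F.conjAvg h = F.avg * h * F.avg := by
  rw [conjAvg_apply, mul_smul_comm, Finset.mul_sum]
  simp_rw [← mul_assoc, avg_mul_grp]
  nth_rw 3 [avg]
  rw [mul_smul_comm, Finset.mul_sum]
  congr 1
  exact Fintype.sum_equiv (Equiv.inv G) _ _ fun _ => rfl

theorem conjAvg_mem_pure {z : ℤ} {a : H} (ha : a ∈ F.pure z) : F.conjAvg a ∈ F.pure z := by
  suffices h : F.pure z ≤ (F.pure z).comap F.conjAvg from h ha
  refine Submodule.span_le.2 ?_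
  rintro _ ⟨w, hw, rfl⟩
  change F.conjAvg _ ∈ F.pure z
  rw [conjAvg_apply]
  refine Submodule.smul_mem _ _ (Submodule.sum_mem _ fun g _ => ?_)
  rw [← mul_assoc, grp_mul_word, mul_assoc, ← map_mul, mul_inv_cancel, map_one, mul_one]
  exact F.word_mem_pure _ (by rwa [List.length_map])

theorem avg_mul_mul_avg_mem {z : ℤ} {h : H} (hh : h ∈ F.filt z) :
    F.avg * h * F.avg ∈ F.sph z := by
  suffices h' : F.filt z ≤ (F.sph z).comap
      (LinearMap.mulRight ℂ F.avg ∘ₗ LinearMap.mulLeft ℂ F.avg) from h' hh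
  refine Submodule.span_le.2 ?_
  rintro _ ⟨w, g, hw, rfl⟩
  change F.avg * (F.word w * F.grp g) * F.avg ∈ F.sph z
  rw [mul_assoc, mul_assoc, grp_mul_avg, ← mul_assoc]
  exact F.mem_sph.2 ⟨_, F.conjAvg_mem_pure (F.word_mem_pure w hw), fun g => F.grp_mul_conjAvg g _,
    F.avg_mul_conjAvg _⟩

theorem sph_of_neg {z : ℤ} (hz : z < 0) : F.sph z = ⊥ := by
  rw [sph, F.pure_of_neg hz, bot_inf_eq, Submodule.map_bot]

theorem total_avg_mul {z : ℤ} {a : H} (ha : a ∈ F.pure z)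
    (hcomm : ∀ g, F.grp g * a = a * F.grp g) : F.total z (F.avg * a) = F.symbol z 1 a := by
  rw [F.avg_mul_comm hcomm, total_mul_avg, F.total_of_mem_pure ha]

theorem smul_symbol_of_comm (hlin : ∀ (g : G) x, lin b (g • x) = g • lin b x) {z : ℤ} {a : H}
    (ha : a ∈ F.pure z) (hcomm : ∀ g, F.grp g * a = a * F.grp g) (g : G) :
    g • F.symbol z 1 a = F.symbol z 1 a := by
  rw [← F.total_of_mem_pure ha, ← F.total_grp_mul hlin (F.pure_le_filt _ ha), hcomm,
    total_mul_grp]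

theorem smul_total (hlin : ∀ (g : G) x, lin b (g • x) = g • lin b x) {z : ℤ} {h : H}
    (hh : h ∈ F.sph z) (g : G) : g • F.total z h = F.total z h := by
  obtain ⟨a, ha, hcomm, rfl⟩ := F.mem_sph.1 hh
  rw [F.total_avg_mul ha hcomm, F.smul_symbol_of_comm hlin ha hcomm]

theorem total_eq_zero_of_mem_sph {y z : ℤ} (hyz : y < z) {h : H} (hh : h ∈ F.sph y) :
    F.total z h = 0 := by
  obtain ⟨a, ha, hcomm, rfl⟩ := F.mem_sph.1 hh
  rw [F.avg_mul_comm hcomm, total_mul_avg, F.total_eq_zero_of_lt hyz (F.pure_le_filt _ ha)]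

theorem isHomogeneous_symbol (n : ℕ) (k : G) (h : H) : (F.symbol n k h).IsHomogeneous n := by
  rw [symbol_apply, hcomp_natCast]
  exact homogeneousComponent_isHomogeneous _ _

theorem isHomogeneous_total (n : ℕ) (h : H) : (F.total n h).IsHomogeneous n := by
  rw [total_apply]
  exact IsHomogeneous.sum _ _ _ fun k _ => F.isHomogeneous_symbol n k h

/-- The representative `a` has vanishing symbol, so it lies in `filt (z - 1)`, possibly with group
elements. Multiplying by `e` on both sides absorbs these. -/
theorem mem_sph_of_total_eq_zero {z : ℤ} {h : H} (hh : h ∈ F.sph z) (h0 : F.total z h = 0) :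
    h ∈ F.sph (z - 1) := by
  obtain ⟨a, ha, hcomm, rfl⟩ := F.mem_sph.1 hh
  rw [F.total_avg_mul ha hcomm] at h0
  have h1 := F.sub_ofPoly_symbol_mem ha
  rw [h0, map_zero, sub_zero] at h1
  have h2 := F.avg_mul_mul_avg_mem h1
  rwa [mul_assoc, ← F.avg_mul_comm hcomm, ← mul_assoc, avg_mul_avg] at h2

theorem avg_mul_mul {a a' : H} (hcomm : ∀ g, F.grp g * a = a * F.grp g) :
    F.avg * a * (F.avg * a') = F.avg * (a * a') := by
  rw [F.avg_mul_comm hcomm, mul_assoc, ← mul_assoc F.avg, avg_mul_avg, ← mul_assoc,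
    ← F.avg_mul_comm hcomm, mul_assoc]

theorem mul_mem_sph {m n : ℤ} {h h' : H} (hh : h ∈ F.sph m) (hh' : h' ∈ F.sph n) :
    h * h' ∈ F.sph (m + n) := by
  obtain ⟨a, ha, hcomm, rfl⟩ := F.mem_sph.1 hh
  obtain ⟨a', ha', hcomm', rfl⟩ := F.mem_sph.1 hh'
  rw [F.avg_mul_mul hcomm]
  exact F.mem_sph.2 ⟨_, F.mul_mem_pure ha ha', fun g => by
    rw [← mul_assoc, hcomm, mul_assoc, hcomm', mul_assoc], rfl⟩

theorem total_mul (hlin : ∀ (g : G) x, lin b (g • x) = g • lin b x) {m n : ℤ} {h h' : H}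
    (hh : h ∈ F.sph m) (hh' : h' ∈ F.sph n) :
    F.total (m + n) (h * h') = F.total m h * F.total n h' := by
  obtain ⟨a, ha, hcomm, rfl⟩ := F.mem_sph.1 hh
  obtain ⟨a', ha', hcomm', rfl⟩ := F.mem_sph.1 hh'
  rw [F.avg_mul_mul hcomm, F.total_avg_mul (F.mul_mem_pure ha ha') (fun g => by
    rw [← mul_assoc, hcomm, mul_assoc, hcomm', mul_assoc]), F.total_avg_mul ha hcomm,
    F.total_avg_mul ha' hcomm', F.symbol_pure_mul hlin ha (F.pure_le_filt _ ha')]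

/-- Of the symbols summed by `total`, those at `k ≠ 1` vanish by `symbol_commutator_eq_zero`; the
one at `1` is the Poisson bracket. -/
theorem commutator_mem_sph (hlin : ∀ (g : G) x, lin b (g • x) = g • lin b x) (hκ : (κ 1).IsAlt)
    (hfaith : ∀ g : G, g ≠ 1 → ∃ x : V, g • x ≠ x) {m n : ℤ} {h h' : H}
    (hh : h ∈ F.sph m) (hh' : h' ∈ F.sph n) :
    h * h' - h' * h ∈ F.sph (m + n - 2) ∧ F.total (m + n - 2) (h * h' - h' * h) =
      poisson b (κ 1) (F.total m h) (F.total n h') := by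
  obtain ⟨a, ha, hcomm, rfl⟩ := F.mem_sph.1 hh
  obtain ⟨a', ha', hcomm', rfl⟩ := F.mem_sph.1 hh'
  obtain ⟨h1, h2⟩ := F.hasBracket hlin hκ ha ha'
  have hc : ∀ g, F.grp g * (a * a' - a' * a) = (a * a' - a' * a) * F.grp g := fun g => by
    rw [mul_sub, sub_mul, ← mul_assoc, ← mul_assoc, hcomm, hcomm', mul_assoc, mul_assoc, hcomm,
      hcomm', ← mul_assoc, ← mul_assoc]
  rw [F.avg_mul_mul hcomm, F.avg_mul_mul hcomm', ← mul_sub, F.total_avg_mul ha hcomm,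
    F.total_avg_mul ha' hcomm', ← h2]
  constructor
  · have := F.avg_mul_mul_avg_mem h1
    rwa [mul_assoc, ← F.avg_mul_comm hc, ← mul_assoc, avg_mul_avg] at this
  · rw [F.avg_mul_comm hc, total_mul_avg, total_apply]
    exact Finset.sum_eq_single 1 (fun k _ hk => F.symbol_commutator_eq_zero hlin hκ (hfaith k hk)
      ha ha' hcomm' (F.smul_symbol_of_comm hlin ha hcomm k)) (by simp)

/-- A linear section of the symbol map on the spherical subalgebra. -/
def lift : MvPolynomial σ ℂ →ₗ[ℂ] H :=
  LinearMap.mulRight ℂ F.avg ∘ₗ LinearMap.mulLeft ℂ F.avg ∘ₗ F.ofPoly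

theorem lift_mem_sph {n : ℕ} {f : MvPolynomial σ ℂ} (hf : f.IsHomogeneous n) :
    F.lift f ∈ F.sph n :=
  F.avg_mul_mul_avg_mem (F.pure_le_filt _ (F.ofPoly_mem_pure hf))

theorem total_lift (hlin : ∀ (g : G) x, lin b (g • x) = g • lin b x) {n : ℕ}
    {f : MvPolynomial σ ℂ} (hf : f.IsHomogeneous n) (hinv : ∀ g : G, g • f = f) :
    F.total n (F.lift f) = f := by
  have hp := F.ofPoly_mem_pure hf
  change F.total n (F.avg * F.ofPoly f * F.avg) = f
  rw [total_mul_avg, avg, smul_mul_assoc, Finset.sum_mul, map_smul, map_sum]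
  simp_rw [F.total_grp_mul hlin (F.pure_le_filt _ hp), F.total_of_mem_pure hp,
    F.symbol_ofPoly hf, hinv]
  rw [Finset.sum_const, Finset.card_univ, ← Nat.cast_smul_eq_nsmul ℂ, smul_smul,
    inv_mul_cancel₀ (card_ne_zero_complex (G := G)), one_smul]

end Spherical

end FlatAlgebra

namespace FlatAlgebra

variable {G V : Type*} [Group G] [Fintype G] [AddCommGroup V] [Module ℂ V]
  [DistribMulAction G V] [SMulCommClass G ℂ V] {σ : Type*} [Fintype σ] {b : Module.Basis σ ℂ V}
  {κ : G → LinearMap.BilinForm ℂ V} {H : Type*} [Ring H] [Algebra ℂ H] (F : FlatAlgebra b κ H)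
  [MulSemiringAction G (MvPolynomial σ ℂ)] [SMulCommClass G ℂ (MvPolynomial σ ℂ)]

/-! ### Homogeneous invariants and the codimension of fixed spaces. -/

section Invariants

theorem isHomogeneous_smul (hlin : ∀ (g : G) x, lin b (g • x) = g • lin b x) (g : G) {n : ℕ}
    {f : MvPolynomial σ ℂ} (hf : f.IsHomogeneous n) : (g • f).IsHomogeneous n := by
  refine isHomogeneous_induction (C := fun f => (g • f).IsHomogeneous n)
    (fun α hα => ?_) ?_ (fun f f' h h' => ?_) (fun z f h => ?_) hf
  · rw [← symProd_toList (b := b), ← symProd_map_smul hlin, ← hα, ← length_toList (b := b),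
      ← List.length_map (f := fun x : V => g • x)]
    exact isHomogeneous_symProd b _
  · rw [smul_zero]; exact isHomogeneous_zero _ _ _
  · rw [smul_add]; exact h.add h'
  · rw [smul_comm, smul_eq_C_mul]
    simpa using h.C_mul z

theorem smul_homogeneousComponent (hlin : ∀ (g : G) x, lin b (g • x) = g • lin b x) (g : G)
    (k : ℕ) (f : MvPolynomial σ ℂ) :
    g • homogeneousComponent k f = homogeneousComponent k (g • f) := by
  have h : ∀ i, homogeneousComponent k (g • homogeneousComponent i f) =
      if i = k then g • homogeneousComponent k f else 0 := fun i => by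
    rw [homogeneousComponent_of_mem
      (isHomogeneous_smul hlin g (homogeneousComponent_isHomogeneous i f))]
    split_ifs with h1 h2 h2
    · rw [h1]
    · exact absurd h1.symm h2
    · exact absurd h2.symm h1
    · rfl
  conv_rhs => rw [← sum_homogeneousComponent f, Finset.smul_sum, map_sum]
  simp_rw [h]
  rw [Finset.sum_ite_eq']
  split_ifs with hk
  · rfl
  · rw [homogeneousComponent_eq_zero _ _ (by simpa using hk), smul_zero]

theorem invariant_induction (hlin : ∀ (g : G) x, lin b (g • x) = g • lin b x)
    {C : MvPolynomial σ ℂ → Prop}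
    (hom : ∀ (n : ℕ) f, f.IsHomogeneous n → (∀ g : G, g • f = f) → C f) (zero : C 0)
    (add : ∀ f f', C f → C f' → C (f + f')) {f : MvPolynomial σ ℂ} (hf : ∀ g : G, g • f = f) :
    C f := by
  rw [← sum_homogeneousComponent f]
  exact Finset.sum_induction _ C add zero fun k _ =>
    hom k _ (homogeneousComponent_isHomogeneous k f) fun g => by
      rw [smul_homogeneousComponent hlin, hf]

/-- A prime dividing all the linear forms `lin b (x - g • x)` would make each of them a scalar
multiple of it. The image of `1 - g` would then be at most a line, on which the alternating form `ω`
is zero. -/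
theorem exists_not_dvd {ω : LinearMap.BilinForm ℂ V} (hω : ω.IsAlt) {g : G}
    (hg : ∃ x y, ω (x - g • x) (y - g • y) ≠ 0) {p : MvPolynomial σ ℂ} (hp : Prime p) :
    ∃ x, ¬ p ∣ lin b x - lin b (g • x) := by
  by_contra! h
  obtain ⟨x, y, hxy⟩ := hg
  have key : ∀ x, x - g • x ≠ 0 → ∃ z : ℂ, z ≠ 0 ∧ lin b (x - g • x) = p * C z := by
    intro x hx
    obtain ⟨q, hq⟩ := h x
    rw [← map_sub] at hq
    have h0 : lin b (x - g • x) ≠ 0 := fun h => hx (lin_injective (h.trans (map_zero _).symm))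
    have hq0 : q ≠ 0 := fun h => h0 (by rw [hq, h, mul_zero])
    have hd : (lin b (x - g • x)).totalDegree = 1 := (isHomogeneous_lin b _).totalDegree h0
    rw [hq, totalDegree_mul_of_isDomain hp.ne_zero hq0] at hd
    have hp1 : p.totalDegree ≠ 0 := fun h => hp.not_isUnit (by
      have h1 := totalDegree_eq_zero_iff_eq_C.1 h
      have h2 : coeff 0 p ≠ 0 := fun h => hp.ne_zero (by rw [h1, h, map_zero])
      rw [h1]
      exact (isUnit_iff_ne_zero.2 h2).map C)
    have h1 := totalDegree_eq_zero_iff_eq_C.1 (show q.totalDegree = 0 by omega)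
    refine ⟨coeff 0 q, fun h => hq0 (by rw [h1, h, map_zero]), ?_⟩
    rw [← h1, hq]
  obtain ⟨z, hz, hz'⟩ := key x fun h => hxy (by rw [h, map_zero, LinearMap.zero_apply])
  obtain ⟨u, hu, hu'⟩ := key y fun h => hxy (by rw [h, map_zero])
  have h1 : z • (y - g • y) = u • (x - g • x) := lin_injective (b := b) (by
    rw [map_smul, map_smul, hz', hu', smul_eq_C_mul, smul_eq_C_mul]; ring)
  have h2 := congrArg (ω (x - g • x)) h1
  rw [map_smul, map_smul, hω, smul_zero, smul_eq_mul] at h2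
  exact (mul_ne_zero hz hxy) h2

end Invariants

/-! ### Lowering the order of commutators until they vanish. -/

section Descent

theorem homogeneousComponent_total {z : ℤ} {k : ℕ} (hk : (k : ℤ) ≠ z) (h : H) :
    homogeneousComponent k (F.total z h) = 0 := by
  rw [total_apply, map_sum]
  exact Finset.sum_eq_zero fun g _ => homogeneousComponent_hcomp hk _

/-- The bilinear map on `S(V)` which takes homogeneous polynomials of degrees `m` and `n` to the
symbol of degree `m + n - d` of the commutator of their lifts. -/
def symbolBracket (d : ℕ) :
    MvPolynomial σ ℂ →ₗ[ℂ] MvPolynomial σ ℂ →ₗ[ℂ] MvPolynomial σ ℂ :=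
  (basisMonomials σ ℂ).constr ℂ fun α => (basisMonomials σ ℂ).constr ℂ fun γ =>
    F.total (α.degree + γ.degree - d) (F.lift (monomial α 1) * F.lift (monomial γ 1) -
      F.lift (monomial γ 1) * F.lift (monomial α 1))

theorem symbolBracket_monomial (d : ℕ) (α γ : σ →₀ ℕ) :
    F.symbolBracket d (monomial α 1) (monomial γ 1) =
      F.total (α.degree + γ.degree - d) (F.lift (monomial α 1) * F.lift (monomial γ 1) -
        F.lift (monomial γ 1) * F.lift (monomial α 1)) := by
  have h := (basisMonomials σ ℂ).constr_basis ℂ (M' := MvPolynomial σ ℂ)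
  have h' := (basisMonomials σ ℂ).constr_basis ℂ (M' := MvPolynomial σ ℂ →ₗ[ℂ] MvPolynomial σ ℂ)
  simp only [coe_basisMonomials] at h h'
  rw [symbolBracket, h', h]

theorem symbolBracket_apply (d : ℕ) {m n : ℕ} {a c : MvPolynomial σ ℂ} (ha : a.IsHomogeneous m)
    (hc : c.IsHomogeneous n) : F.symbolBracket d a c =
      F.total (m + n - d) (F.lift a * F.lift c - F.lift c * F.lift a) := by
  refine isHomogeneous_induction (C := fun a => F.symbolBracket d a c =
    F.total (m + n - d) (F.lift a * F.lift c - F.lift c * F.lift a))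
    (fun α hα => ?_) (by simp) (fun f f' h h' => ?_) (fun z f h => ?_) ha
  · refine isHomogeneous_induction (C := fun c => F.symbolBracket d (monomial α 1) c =
      F.total (m + n - d) (F.lift (monomial α 1) * F.lift c - F.lift c * F.lift (monomial α 1)))
      (fun γ hγ => ?_) (by simp) (fun f f' h h' => ?_) (fun z f h => ?_) hc
    · rw [symbolBracket_monomial, hα, hγ]
    · rw [map_add, h, h', ← map_add, map_add F.lift, mul_add, add_mul]
      congr 1
      abel
    · rw [map_smul, h, ← map_smul, map_smul F.lift, mul_smul_comm, smul_mul_assoc, smul_sub]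
  · rw [map_add, LinearMap.add_apply, h, h', ← map_add, map_add F.lift, mul_add, add_mul]
    congr 1
    abel
  · rw [map_smul, LinearMap.smul_apply, h, ← map_smul, map_smul F.lift, mul_smul_comm,
      smul_mul_assoc, smul_sub]

theorem symbolBracket_swap (d : ℕ) (a c : MvPolynomial σ ℂ) :
    F.symbolBracket d a c = -F.symbolBracket d c a := by
  have : F.symbolBracket d = -(F.symbolBracket d).flip := by
    refine (basisMonomials σ ℂ).ext fun α => (basisMonomials σ ℂ).ext fun γ => ?_
    simp only [coe_basisMonomials, LinearMap.neg_apply, LinearMap.flip_apply]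
    rw [symbolBracket_monomial, symbolBracket_monomial, ← map_neg, neg_sub, add_comm]
  exact congrArg (fun q => q a c) this

variable {d : ℕ}

theorem symbolBracket_leibniz (hlin : ∀ (g : G) x, lin b (g • x) = g • lin b x)
    (hd : ∀ (m n : ℤ) (h h' : H), h ∈ F.sph m → h' ∈ F.sph n →
      h * h' - h' * h ∈ F.sph (m + n - d)) (a a' c : MvPolynomial σ ℂ)
    (ha : ∀ g : G, g • a = a) (ha' : ∀ g : G, g • a' = a') (hc : ∀ g : G, g • c = c) :
    F.symbolBracket d (a * a') c =
      a * F.symbolBracket d a' c + a' * F.symbolBracket d a c := by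
  refine invariant_induction hlin (C := fun a => F.symbolBracket d (a * a') c =
    a * F.symbolBracket d a' c + a' * F.symbolBracket d a c) (fun m a ham ha => ?_) (by simp)
    (fun f f' h h' => by
      rw [add_mul, map_add, LinearMap.add_apply, h, h', map_add, LinearMap.add_apply]; ring) ha
  refine invariant_induction hlin (C := fun a' => F.symbolBracket d (a * a') c =
    a * F.symbolBracket d a' c + a' * F.symbolBracket d a c) (fun m' a' ham' ha' => ?_) (by simp)
    (fun f f' h h' => by
      rw [mul_add, map_add, LinearMap.add_apply, h, h', map_add, LinearMap.add_apply]; ring) ha'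
  refine invariant_induction hlin (C := fun c => F.symbolBracket d (a * a') c =
    a * F.symbolBracket d a' c + a' * F.symbolBracket d a c) (fun n c hcn hc => ?_) (by simp)
    (fun f f' h h' => by rw [map_add, h, h', map_add, map_add]; ring) hc
  rw [F.symbolBracket_apply d (ham.mul ham') hcn, F.symbolBracket_apply d ham hcn,
    F.symbolBracket_apply d ham' hcn]
  have la := F.lift_mem_sph ham
  have la' := F.lift_mem_sph ham'
  have lc := F.lift_mem_sph hcn
  have lm := F.lift_mem_sph (ham.mul ham')
  have hinv : ∀ g : G, g • (a * a') = a * a' := fun g => by rw [smul_mul', ha, ha']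
  rw [Nat.cast_add] at lm
  -- The lift of `a * a'` and the product of the lifts have the same symbol. Their difference has
  -- lower order, so its commutator with the lift of `c` contributes nothing in the degree
  -- considered.
  have hr := F.mem_sph_of_total_eq_zero (Submodule.sub_mem _ lm (F.mul_mem_sph la la')) (by
    have := F.total_lift hlin (ham.mul ham') hinv
    rw [Nat.cast_add] at this
    rw [map_sub, this, F.total_mul hlin la la', F.total_lift hlin ham ha,
      F.total_lift hlin ham' ha', sub_self])
  have h0 := F.total_eq_zero_of_mem_sph (z := ((m + m' : ℕ) : ℤ) + n - d)
    (by push_cast; omega) (hd _ _ _ _ hr lc)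
  have h1 := F.total_mul hlin la (hd _ _ _ _ la' lc)
  have h2 := F.total_mul hlin (hd _ _ _ _ la lc) la'
  rw [show (m : ℤ) + (m' + n - d) = ((m + m' : ℕ) : ℤ) + n - d by push_cast; ring,
    F.total_lift hlin ham ha] at h1
  rw [show (m : ℤ) + n - d + m' = ((m + m' : ℕ) : ℤ) + n - d by push_cast; ring,
    F.total_lift hlin ham' ha'] at h2
  have e : F.lift (a * a') * F.lift c - F.lift c * F.lift (a * a') =
      ((F.lift (a * a') - F.lift a * F.lift a') * F.lift c -
        F.lift c * (F.lift (a * a') - F.lift a * F.lift a')) +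
      (F.lift a * (F.lift a' * F.lift c - F.lift c * F.lift a') +
        (F.lift a * F.lift c - F.lift c * F.lift a) * F.lift a') := by
    simp only [mul_sub, sub_mul, mul_assoc]; abel
  rw [e, map_add, map_add, h0, h1, h2]
  ring

theorem commutator_mem_sph_succ (hlin : ∀ (g : G) x, lin b (g • x) = g • lin b x)
    (hp : ∀ g : G, g ≠ 1 → ∀ p, Prime p → ∃ x, ¬ p ∣ lin b x - lin b (g • x)) (h3 : 3 ≤ d)
    (hd : ∀ (m n : ℤ) (h h' : H), h ∈ F.sph m → h' ∈ F.sph n →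
      h * h' - h' * h ∈ F.sph (m + n - d)) (m n : ℤ) (h h' : H) (hh : h ∈ F.sph m)
    (hh' : h' ∈ F.sph n) : h * h' - h' * h ∈ F.sph (m + n - (d + 1 : ℕ)) := by
  rcases lt_or_ge m 0 with hm | hm
  · rw [F.sph_of_neg hm, Submodule.mem_bot] at hh
    simp [hh]
  rcases lt_or_ge n 0 with hn | hn
  · rw [F.sph_of_neg hn, Submodule.mem_bot] at hh'
    simp [hh']
  obtain ⟨m, rfl⟩ := Int.eq_ofNat_of_zero_le hm
  obtain ⟨n, rfl⟩ := Int.eq_ofNat_of_zero_le hn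
  have ham := F.isHomogeneous_total m h
  have hcn := F.isHomogeneous_total n h'
  have ha := F.smul_total hlin hh
  have hc := F.smul_total hlin hh'
  have la := F.lift_mem_sph ham
  have lc := F.lift_mem_sph hcn
  have ra := F.mem_sph_of_total_eq_zero (Submodule.sub_mem _ hh la) (by
    rw [map_sub, F.total_lift hlin ham ha, sub_self])
  have rc := F.mem_sph_of_total_eq_zero (Submodule.sub_mem _ hh' lc) (by
    rw [map_sub, F.total_lift hlin hcn hc, sub_self])
  have h0 : F.symbolBracket d (F.total m h) (F.total n h') = 0 :=
    biderivation_eq_zero (lin b) (fun i => ⟨b i, lin_basis b i⟩) hlin hp (F.symbolBracket d)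
      (F.symbolBracket_leibniz hlin hd)
      (fun a c c' ha hc hc' => by
        rw [symbolBracket_swap, F.symbolBracket_leibniz hlin hd c c' a hc hc' ha,
          F.symbolBracket_swap d a c', F.symbolBracket_swap d a c]
        ring) h3 ha hc ham hcn (fun k hk => by
        rw [F.symbolBracket_apply d ham hcn]
        exact F.homogeneousComponent_total (by omega) _)
  rw [F.symbolBracket_apply d ham hcn] at h0
  have h1 := F.mem_sph_of_total_eq_zero (hd _ _ _ _ la lc) h0
  have h2 := hd _ _ _ _ ra hh'
  have h4 := hd _ _ _ _ la rc
  rw [show (m : ℤ) + n - d - 1 = m + n - (d + 1 : ℕ) by push_cast; ring] at h1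
  rw [show (m : ℤ) - 1 + n - d = m + n - (d + 1 : ℕ) by push_cast; ring] at h2
  rw [show (m : ℤ) + (n - 1) - d = m + n - (d + 1 : ℕ) by push_cast; ring] at h4
  -- Replacing `h` and `h'` by the lifts of their symbols changes the commutator by commutators with
  -- remainders of order one less.
  convert Submodule.add_mem _ (Submodule.add_mem _ h1 h2) h4 using 1
  simp only [mul_sub, sub_mul]
  abel

/-- If the vectors commute up to group elements other than `1`, the spherical subalgebra is
commutative. -/
theorem commute_of_eq_zero (hlin : ∀ (g : G) x, lin b (g • x) = g • lin b x)
    (hfaith : ∀ g : G, g ≠ 1 → ∃ x : V, g • x ≠ x)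
    (hp : ∀ g : G, g ≠ 1 → ∀ p, Prime p → ∃ x, ¬ p ∣ lin b x - lin b (g • x))
    (hκ : κ 1 = 0) (h h' : H) :
    F.avg * h * F.avg * (F.avg * h' * F.avg) = F.avg * h' * F.avg * (F.avg * h * F.avg) := by
  -- The Poisson bracket of `κ 1 = 0` is zero, so the symbol in degree `m + n - 2` vanishes. This
  -- supplies the bound `d ≥ 3` that the descent needs.
  have base : ∀ (m n : ℤ) (h h' : H), h ∈ F.sph m → h' ∈ F.sph n →
      h * h' - h' * h ∈ F.sph (m + n - (3 : ℕ)) := by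
    intro m n h h' hh hh'
    obtain ⟨h1, h2⟩ := F.commutator_mem_sph hlin (fun x => by rw [hκ]; rfl) hfaith hh hh'
    have := F.mem_sph_of_total_eq_zero h1 (by rw [h2, hκ, poisson_apply]; simp)
    rwa [show m + n - 2 - 1 = m + n - (3 : ℕ) by push_cast; ring] at this
  have all : ∀ d : ℕ, ∀ (m n : ℤ) (h h' : H), h ∈ F.sph m → h' ∈ F.sph n →
      h * h' - h' * h ∈ F.sph (m + n - (3 + d : ℕ)) := by
    intro d
    induction d with
    | zero => exact base
    | succ d ih => exact F.commutator_mem_sph_succ hlin hp (Nat.le_add_right 3 d) ih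
  obtain ⟨m, hm⟩ := F.exists_mem_filt h
  obtain ⟨n, hn⟩ := F.exists_mem_filt h'
  -- With `d = m + n` the commutator has order at most `-3`, so it is zero.
  have := all (m + n) m n _ _ (F.avg_mul_mul_avg_mem hm) (F.avg_mul_mul_avg_mem hn)
  rw [F.sph_of_neg (by push_cast; omega), Submodule.mem_bot] at this
  exact sub_eq_zero.1 this

/-- If the spherical subalgebra is commutative, the vectors commute up to group elements other
than `1`. -/
theorem eq_zero_of_commute (hlin : ∀ (g : G) x, lin b (g • x) = g • lin b x)
    (hfaith : ∀ g : G, g ≠ 1 → ∃ x : V, g • x ≠ x)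
    (hp : ∀ g : G, g ≠ 1 → ∀ p, Prime p → ∃ x, ¬ p ∣ lin b x - lin b (g • x))
    (hκ : (κ 1).IsAlt)
    (hcomm : ∀ h h' : H, F.avg * h * F.avg * (F.avg * h' * F.avg) =
      F.avg * h' * F.avg * (F.avg * h * F.avg)) : κ 1 = 0 := by
  have h1 : ∀ f h : MvPolynomial σ ℂ, (∀ g : G, g • f = f) → (∀ g : G, g • h = h) →
      poisson b (κ 1) f h = 0 := by
    intro f h hf hh
    refine invariant_induction hlin (C := fun f => poisson b (κ 1) f h = 0)
      (fun m f hfm hf => ?_) (by rw [poisson_swap b hκ, map_zero, neg_zero])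
      (fun f f' h h' => by
        rw [poisson_swap b hκ, map_add, neg_add, ← poisson_swap b hκ, ← poisson_swap b hκ, h, h',
          add_zero]) hf
    refine invariant_induction hlin (C := fun h => poisson b (κ 1) f h = 0)
      (fun n h hhn hh => ?_) (map_zero _) (fun f f' h h' => by rw [map_add, h, h', add_zero]) hh
    have := (F.commutator_mem_sph hlin hκ hfaith (F.lift_mem_sph hfm) (F.lift_mem_sph hhn)).2
    rw [F.total_lift hlin hfm hf, F.total_lift hlin hhn hh] at this
    rw [← this]
    change F.total _ (F.avg * _ * F.avg * (F.avg * _ * F.avg) -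
      F.avg * _ * F.avg * (F.avg * _ * F.avg)) = 0
    rw [hcomm, sub_self, map_zero]
  have hX : ∀ i, ∃ x, lin b x = X i := fun i => ⟨b i, lin_basis b i⟩
  have h2 : ∀ f h : MvPolynomial σ ℂ, (∀ g : G, g • f = f) → poisson b (κ 1) f h = 0 := by
    intro f h hf
    -- The bracket vanishes on pairs of invariants. As a derivation in each variable, it vanishes on
    -- all polynomials, one variable at a time.
    rw [derivation_eq_zero_of_invariant (lin b) hX hlin hp (poisson b (κ 1) f)
      (fun h hh => h1 f h hf hh)]
    rfl
  have h3 : ∀ f : MvPolynomial σ ℂ, poisson b (κ 1) f = 0 := fun f =>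
    derivation_eq_zero_of_invariant (lin b) hX hlin hp _ fun h hh => by
      rw [poisson_swap b hκ, h2 h f hh, neg_zero]
  ext x y
  have := poisson_lin b hκ x y
  rw [h3] at this
  exact (C_eq_zero.1 this.symm)

end Descent

end FlatAlgebra

section Action

variable {G V : Type*} [Group G] [AddCommGroup V] [Module ℂ V] [DistribMulAction G V]
  [SMulCommClass G ℂ V] {σ : Type*} (b : Module.Basis σ ℂ V)

/-- The algebra endomorphism of `S(V)` induced by the action of `g` on `V`. -/
def polyMap (g : G) : MvPolynomial σ ℂ →ₐ[ℂ] MvPolynomial σ ℂ := aeval fun i => lin b (g • b i)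

theorem polyMap_lin (g : G) (x : V) : polyMap b g (lin b x) = lin b (g • x) := by
  have : (polyMap b g).toLinearMap ∘ₗ lin b = lin b ∘ₗ DistribSMul.toLinearMap ℂ V g :=
    b.ext fun i => by
      simp only [LinearMap.comp_apply, lin_basis]
      exact aeval_X _ i
  exact LinearMap.congr_fun this x

theorem polyMap_X (g : G) (i : σ) : polyMap b g (X i) = lin b (g • b i) := aeval_X _ i

/-- The action of `G` on `S(V)` by algebra automorphisms. -/
@[reducible]
def polyAction : MulSemiringAction G (MvPolynomial σ ℂ) where
  smul g f := polyMap b g f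
  one_smul f := by
    change polyMap b (1 : G) f = f
    have h : polyMap b (1 : G) = AlgHom.id ℂ (MvPolynomial σ ℂ) :=
      algHom_ext fun i => by rw [polyMap_X, one_smul, lin_basis]; rfl
    rw [h]; rfl
  mul_smul g h f := by
    change polyMap b (g * h) f = polyMap b g (polyMap b h f)
    have e : polyMap b (g * h) = (polyMap b g).comp (polyMap b h) :=
      algHom_ext fun i => by
        rw [AlgHom.comp_apply, polyMap_X, polyMap_X, polyMap_lin, mul_smul]
    rw [e]; rfl
  smul_zero g := map_zero (polyMap b g)
  smul_add g := map_add (polyMap b g)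
  smul_one g := map_one (polyMap b g)
  smul_mul g := map_mul (polyMap b g)

end Action

end SymplecticReflection

end

theorem mainTheorem7 {G V : Type*} [Group G] [Fintype G] [AddCommGroup V] [Module ℂ V]
    [FiniteDimensional ℂ V] [Nontrivial V] [DistribMulAction G V] [SMulCommClass G ℂ V]
    [FaithfulSMul G V] (ω : LinearMap.BilinForm ℂ V) (hω_alt : ω.IsAlt)
    (hω_nondeg : ω.Nondegenerate)
    (hω_inv : ∀ (g : G) (x y : V), ω (g • x) (g • y) = ω x y)
    (hω_unique : ∀ η : LinearMap.BilinForm ℂ V, η.IsAlt →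
      (∀ (g : G) (x y : V), η (g • x) (g • y) = η x y) → ∃ z : ℂ, η = z • ω)
    (t : ℂ) (c : SymplecticReflection.reflections G V → ℂ)
    (hc : ∀ s s' : SymplecticReflection.reflections G V, IsConj (s : G) (s' : G) → c s = c s') :
    (∀ a b : SymplecticReflection.Spherical ω t c, a * b = b * a) ↔ t = 0 := by
  open SymplecticReflection in
  let b := Module.finBasis ℂ V
  let _ : MulSemiringAction G (MvPolynomial (Fin (Module.finrank ℂ V)) ℂ) := polyAction b
  have _ : SMulCommClass G ℂ (MvPolynomial (Fin (Module.finrank ℂ V)) ℂ) :=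
    ⟨fun g z f => map_smul (polyMap b g) z f⟩
  have hlin : ∀ (g : G) x, lin b (g • x) = g • lin b x := fun g x => (polyMap_lin b g x).symm
  have hfaith : ∀ g : G, g ≠ 1 → ∃ x : V, g • x ≠ x := fun g hg => by
    by_contra! h
    exact hg (FaithfulSMul.eq_of_smul_eq_smul (α := V) fun x => by rw [h, one_smul])
  have hp : ∀ g : G, g ≠ 1 → ∀ p, Prime p → ∃ x, ¬ p ∣ lin b x - lin b (g • x) :=
    fun g hg p hp => FlatAlgebra.exists_not_dvd hω_alt
      (exists_oneSub_ne_zero ω hω_nondeg hω_inv hg) hp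
  obtain ⟨F, hF⟩ := exists_flatAlgebra (isFlatBracket_coupling ω t c hω_alt hω_inv hc) b
  have hF' : F.avg = symmetrizer ω t c := by rw [FlatAlgebra.avg, hF]; rfl
  have hiff : (∀ a b : Spherical ω t c, a * b = b * a) ↔
      ∀ h h' : Alg ω t c, F.avg * h * F.avg * (F.avg * h' * F.avg) =
        F.avg * h' * F.avg * (F.avg * h * F.avg) := by
    rw [hF']
    constructor
    · intro h x y
      exact congrArg Subtype.val (h ⟨_, x, rfl⟩ ⟨_, y, rfl⟩)
    · rintro h ⟨_, x, rfl⟩ ⟨_, y, rfl⟩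
      exact Subtype.ext (h x y)
  have ht : coupling ω t c 1 = 0 ↔ t = 0 := by
    rw [coupling_one]
    -- As `ω` is nondegenerate and `V ≠ 0`, the form `t • ω` is zero only for `t = 0`.
    refine ⟨fun h => ?_, fun h => by rw [h, zero_smul]⟩
    obtain ⟨x, hx⟩ := exists_ne (0 : V)
    by_contra ht
    exact hx (hω_nondeg.1 x fun y => by
      have := congrArg (fun q => q x y) h
      exact (mul_eq_zero.1 this).resolve_left ht)
  rw [hiff, ← ht]
  exact ⟨F.eq_zero_of_commute hlin hfaith hp (fun x => by
    rw [coupling_one]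
    change t * ω x x = 0
    rw [hω_alt, mul_zero]), F.commute_of_eq_zero hlin hfaith hp⟩
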